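/- **Soundness of the equational theory of plain Dirac notation.** *Syntax.* All syntactic objects are taken up to renaming of bound variables. Indices: $\sigma ::= x \mid \mathsf{bool} \mid \sigma_1\times\sigma_2$. Types: $T ::= \mathrm{Basis}(\sigma)\mid \mathcal S\mid \mathcal K(\sigma)\mid \mathcal B(\sigma)\mid \mathcal O(\sigma_1,\sigma_2)\mid T_1\to T_2\mid \forall x.T\mid \mathrm{Set}(\sigma)$ (basis elements, scalars, kets, bras, operators with domain $\sigma_2$ and codomain $\sigma_1$, functions, index-polymorphic functions, subsets). Terms: variables, $\lambda x{:}T.e$, $\lambda x{:}\mathrm{Index}.e$, application to a term or to an index, basis pairs $(e_1,e_2)$, the basis elements $0,1$ of $\mathsf{bool}$; scalars $0$, $1$, $e_1\times e_2$, $e^*$, $\delta_{e_1,e_2}$; $\mathbf 0_{\mathcal K}(\sigma)$, $\mathbf 0_{\mathcal B}(\sigma)$, $\mathbf 0_{\mathcal O}(\sigma,\tau)$, $\mathbf 1_{\mathcal O}(\sigma)$; $|e\rangle$, $\langle e|$, $e^\dagger$, $e_1.e_2$, $e_1+e_2$, $e_1\otimes e_2$, $e_1\cdot e_2$; the sets $\mathbf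 U(\sigma)$, $e_1\star e_2$; and $\sum_{e_1}e_2$, where $\sum_{x\in M}A$ stands for $\sum_M\lambda x{:}T.A$. Sums and products of more than two terms are iterated binary ones. A context $\Gamma$ is a list of declarations $x:\mathrm{Index}$, $x:T$, $x:=t:T$ of distinct variables. The judgments "$\Gamma$ is well formed", $\Gamma\vdash\sigma:\mathrm{Index}$, $\Gamma\vdash T:\mathrm{Type}$, $\Gamma\vdash t:T$ are given by the usual rules; the typed products are $B\cdot K:\mathcal S$, $O\cdot K$, $B\cdot O$, $K\cdot B$, $O_1\cdot O_2$ with matching indices, $\otimes$ joins two kets, two bras or two operators, $a.D$ needs a scalar $a$ and a ket, bra or operator $D$, and $\sum_s f$ needs $s:\mathrm{Set}(\sigma)$ and $f:\mathrm{Basis}(\sigma)\to T$ with $T$ a type of scalars, kets, bras or operators. *Semantics.* A valuation $v$ assigns finite sets (possibly empty) to index variables and values to term variables. $[\![\mathsf{bool}]\!]$ is a two-element set, $[\![\sigma\times\tau]\!]=[\![\sigma]\!]\times[\![\tau]\!]$; $[\![\mathrm{Basis}(\sigma)]\!]=[\![\sigma]\!]$, $[\![\mathcal S]\!]=\mathbb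 C$, $[\![\mathcal K(\sigma)]\!]=\mathcal H_{[\![\sigma]\!]}$ (the finite-dimensional Hilbert space with orthonormal basis $[\![\sigma]\!]$), $[\![\mathcal B(\sigma)]\!]=\mathcal H_{[\![\sigma]\!]}^*$, $[\![\mathcal O(\sigma,\tau)]\!]=\mathcal L(\mathcal H_{[\![\tau]\!]},\mathcal H_{[\![\sigma]\!]})$, $[\![\mathrm{Set}(\sigma)]\!]=\mathcal P([\![\sigma]\!])$; $[\![T\to U]\!]$ is the set of all functions, and $[\![\forall x.T]\!]$ is the product of $[\![T]\!]_{v[x\mapsto X]}$ over all finite sets $X$. Terms denote as usual: $\cdot$ is the product of matrices (application, composition, outer product), $\otimes$ the Kronecker product, $\dagger$ the adjoint, $[\![\sum_{i\in M}X]\!]_v=\sum_{m\in[\![M]\!]_v}[\![X]\!]_{v[i\mapsto m]}$, $\mathbf U(\sigma)$ the full set, $\star$ the Cartesian product. The valuation $v$ is valid for $\Gamma$ if $v(x)\in[\![T]\!]_v$ for each $x:T$ in $\Gamma$ and $v(x)=[\![t]\!]_v$ for each $x:=t:T$ in $\Gamma$. *Equational theory.* Let $\Phi$ be a finite (possibly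 empty) list of hypotheses $s\neq t$. $\Gamma;\Phi\vdash e_1=e_2:T$ means that $e_1=e_2$ is derived by typed equational logic (reflexivity, symmetry, transitivity, and congruence for all term formers, also under $\lambda$, each equation in the derivation having both sides of the same type in its context) from all those instances of the following axioms whose two sides have the same type. Here $D$ stands for kets, bras or operators, $\mathbf 0$ for the zero of the type required, and a bound variable does not occur in a subterm that stands outside its scope on the other side or in the range of another sum. - Scalars: $+,\times,0,1$ satisfy the commutative semiring laws, ${}^*$ is an involution that preserves $+,\times,0,1$; $(B\cdot K)^*=K^\dagger\cdot B^\dagger$. - Delta: $\delta_{s,t}^*=\delta_{s,t}$, $\langle s|\cdot|t\rangle=\delta_{s,t}$, $\delta_{s,s}=1$, $\delta_{s,t}=0$ if $(s\ne t)\in\Phi$, $\delta_{s,t}=\delta_{t,s}$. - Linearity: $\mathbf 0+D=D$, $D_1+D_2=D_2+D_1$, $(D_1+D_2)+D_3=D_1+(D_2+D_3)$, $0.D=\mathbf 0$, $a.\mathbf 0=\mathbf 0$, $1.D=D$, $a.(b.D)=(a\times b).D$, $(a+b).D=a.D+b.D$, $a.(D_1+D_2)=a.D_1+a.D_2$. -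 Bilinearity: $\cdot$ and $\otimes$ are additive and homogeneous in both arguments and vanish if one argument is $\mathbf 0$ (for $B\cdot K$, scaling means the product of scalars). - Adjoint: $\mathbf 0^\dagger=\mathbf 0$, $(D^\dagger)^\dagger=D$, $(a.D)^\dagger=a^*.D^\dagger$, $(D_1+D_2)^\dagger=D_1^\dagger+D_2^\dagger$, $(D_1\cdot D_2)^\dagger=D_2^\dagger\cdot D_1^\dagger$, $(D_1\otimes D_2)^\dagger=D_1^\dagger\otimes D_2^\dagger$. - Composition: $D_0\cdot(D_1\cdot D_2)=(D_0\cdot D_1)\cdot D_2$, $(D_1\otimes D_2)\cdot(D_3\otimes D_4)=(D_1\cdot D_3)\otimes(D_2\cdot D_4)$, $(K_1\cdot B)\cdot K_2=(B\cdot K_2).K_1$, $B_1\cdot(K\cdot B_2)=(B_1\cdot K).B_2$, $(B_1\otimes B_2)\cdot(K_1\otimes K_2)=(B_1\cdot K_1)\times(B_2\cdot K_2)$. - Ground: $\mathbf 1_{\mathcal O}^\dagger=\mathbf 1_{\mathcal O}$, $\mathbf 1_{\mathcal O}\cdot D=D$, $\mathbf 1_{\mathcal O}\otimes\mathbf 1_{\mathcal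 O}=\mathbf 1_{\mathcal O}$, $|t\rangle^\dagger=\langle t|$, $|s\rangle\otimes|t\rangle=|(s,t)\rangle$. - Sums: $\sum_{i\in M}\mathbf 0=\mathbf 0$; $\sum_{i\in\mathbf U(\sigma)}|i\rangle\cdot\langle i|=\mathbf 1_{\mathcal O}(\sigma)$; for $i$ not occurring in $t$: $\sum_{i\in\mathbf U(\sigma)}\delta_{i,t}=1$, $\sum_{i\in\mathbf U(\sigma)}\delta_{i,t}.A=A\{i/t\}$; $\sum_{i\in M}\sum_{j\in M}\delta_{i,j}=\sum_{j\in M}1$, $\sum_{i\in M}\sum_{j\in M}\delta_{i,j}.A=\sum_{j\in M}A\{i/j\}$ (the two laws with $A$ also for a scalar $A$, with $\times$ for the scaling); $\times$, ${}^*$, $\dagger$, scaling in both arguments, $\cdot$ and $\otimes$ in both arguments, and $+$ commute with $\sum_{i\in M}$; $\sum_{i\in\mathbf U(\sigma\times\tau)}A=\sum_{j\in\mathbf U(\sigma)}\sum_{k\in\mathbf U(\tau)}A\{i/(j,k)\}$; $\sum_{i\in M_1\star M_2}A=\sum_{j\in M_1}\sum_{k\in M_2}A\{i/(j,k)\}$;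 (SUM-SWAP) $\sum_{i\in s_1}\sum_{j\in s_2}A=\sum_{j\in s_2}\sum_{i\in s_1}A$; $\mathbf U(\sigma)\star\mathbf U(\tau)=\mathbf U(\sigma\times\tau)$. - $\mathsf{bool}$: $\delta_{0,1}=0$, $\sum_{i\in\mathbf U(\mathsf{bool})}A=A\{i/0\}+A\{i/1\}$. - Functions and definitions: $\alpha$-equivalence $\lambda x.A=\lambda y.A\{x/y\}$ (built into the syntax), $(\lambda x{:}T.t)\,u=t\{x/u\}$, $(\lambda x{:}\mathrm{Index}.t)\,\sigma=t\{x/\sigma\}$, and $x=t$ if $x:=t:T$ is in $\Gamma$. **Theorem.** If $\Gamma;\Phi\vdash e_1=e_2:T$, then for every valuation $v$ that is valid for $\Gamma$ and satisfies $[\![s]\!]_v\ne[\![t]\!]_v$ for all hypotheses $s\ne t$ in $\Phi$, both $[\![e_1]\!]_v$ and $[\![e_2]\!]_v$ are defined elements of $[\![T]\!]_v$ and $[\![e_1]\!]_v=[\![e_2]\!]_v$. In particular (for $\Phi$ empty), $\Gamma\vdash e_1=e_2:T$ implies $\Gamma\vDash e_1=e_2$. -/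

import Mathlib

/-!
Plain Dirac notation: syntax, typing, denotational semantics and equational theory.

Terms, types and contexts are written with de Bruijn indices, so syntactic objects are taken up to
renaming of bound variables.  Index variables and term variables share one numbering, because they
are declared in one and the same context.
-/

namespace Dirac

/-! ### Syntax -/

/-- Type indices `σ ::= x | bool | σ₁ × σ₂`. -/
inductive Idx : Type
  | var (n : ℕ)
  | bool
  | prod (σ τ : Idx)

/-- Types.  `opt σ τ` is the type of operators with codomain `σ` and domain `τ`; `all T` is
`∀ x. T`, and binds one (index) variable in `T`. -/
inductive Ty : Type
  | basis (σ : Idx)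
  | scalar
  | ket (σ : Idx)
  | bra (σ : Idx)
  | opt (σ τ : Idx)
  | arrow (T U : Ty)
  | all (T : Ty)
  | set (σ : Idx)

/-- Unary symbols: `a^*`, `|t⟩`, `⟨t|`, `D†`. -/
inductive UnOp : Type
  | conj | ket | bra | dag

/-- Binary symbols: the basis pair `(s, t)`, `δ_{s,t}`, the product of scalars `a × b`, the scaling
`a.D`, and `D₁ + D₂`, `D₁ ⊗ D₂`, `D₁ · D₂`, `M₁ ⋆ M₂`. -/
inductive BinOp : Type
  | pair | delta | mul | smul | add | tensor | dot | star

/-- Terms. `lam T t` is `λ x : T. t` and `ilam t` is `λ x : Index. t`; both bind one variable in `t`.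
`app t u` is the application to a term, `iapp t σ` the application to an index. `b0`, `b1` are
the two basis elements of `bool`, `sc0`, `sc1` are the scalars `0`, `1`. -/
inductive Term : Type
  | var (n : ℕ)
  | lam (T : Ty) (t : Term)
  | ilam (t : Term)
  | app (t u : Term)
  | iapp (t : Term) (σ : Idx)
  | b0
  | b1
  | sc0
  | sc1
  | zeroK (σ : Idx)
  | zeroB (σ : Idx)
  | zeroO (σ τ : Idx)
  | oneO (σ : Idx)
  | univ (σ : Idx)
  | un (o : UnOp) (t : Term)
  | bin (o : BinOp) (t u : Term)
  | sum (s f : Term)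

namespace Term

abbrev conj (a : Term) : Term := un .conj a
abbrev ket (t : Term) : Term := un .ket t
abbrev bra (t : Term) : Term := un .bra t
abbrev dag (D : Term) : Term := un .dag D
abbrev pair (s t : Term) : Term := bin .pair s t
abbrev delta (s t : Term) : Term := bin .delta s t
abbrev mul (a b : Term) : Term := bin .mul a b
abbrev smul (a D : Term) : Term := bin .smul a D
abbrev add (D₁ D₂ : Term) : Term := bin .add D₁ D₂
abbrev tensor (D₁ D₂ : Term) : Term := bin .tensor D₁ D₂
abbrev dot (D₁ D₂ : Term) : Term := bin .dot D₁ D₂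
abbrev star (M₁ M₂ : Term) : Term := bin .star M₁ M₂

/-- `∑_{x ∈ M} A`, i.e. `∑_M (λ x : T. A)`; the variable `x` is number `0` in `A`. -/
abbrev bsum (M : Term) (T : Ty) (A : Term) : Term := sum M (lam T A)

end Term

/-! ### Renaming and substitution -/

/-- A renaming, pushed under a binder. -/
def upRen (f : ℕ → ℕ) : ℕ → ℕ
  | 0 => 0
  | n + 1 => f n + 1

def Idx.ren (f : ℕ → ℕ) : Idx → Idx
  | .var n => .var (f n)
  | .bool => .bool
  | .prod σ τ => .prod (σ.ren f) (τ.ren f)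

def Ty.ren (f : ℕ → ℕ) : Ty → Ty
  | .basis σ => .basis (σ.ren f)
  | .scalar => .scalar
  | .ket σ => .ket (σ.ren f)
  | .bra σ => .bra (σ.ren f)
  | .opt σ τ => .opt (σ.ren f) (τ.ren f)
  | .arrow T U => .arrow (T.ren f) (U.ren f)
  | .all T => .all (T.ren (upRen f))
  | .set σ => .set (σ.ren f)

def Term.ren (f : ℕ → ℕ) : Term → Term
  | .var n => .var (f n)
  | .lam T t => .lam (T.ren f) (t.ren (upRen f))
  | .ilam t => .ilam (t.ren (upRen f))
  | .app t u => .app (t.ren f) (u.ren f)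
  | .iapp t σ => .iapp (t.ren f) (σ.ren f)
  | .b0 => .b0
  | .b1 => .b1
  | .sc0 => .sc0
  | .sc1 => .sc1
  | .zeroK σ => .zeroK (σ.ren f)
  | .zeroB σ => .zeroB (σ.ren f)
  | .zeroO σ τ => .zeroO (σ.ren f) (τ.ren f)
  | .oneO σ => .oneO (σ.ren f)
  | .univ σ => .univ (σ.ren f)
  | .un o t => .un o (t.ren f)
  | .bin o t u => .bin o (t.ren f) (u.ren f)
  | .sum s g => .sum (s.ren f) (g.ren f)

/-- Weakening by one variable: the new variable `0` does not occur in the result. -/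
abbrev Ty.lift (T : Ty) : Ty := T.ren Nat.succ
abbrev Term.lift (t : Term) : Term := t.ren Nat.succ

/-- Substitutions of indices for index variables and of terms for term variables, pushed under a
binder. -/
def upIdx (ρ : ℕ → Idx) : ℕ → Idx
  | 0 => .var 0
  | n + 1 => (ρ n).ren Nat.succ

def upTerm (s : ℕ → Term) : ℕ → Term
  | 0 => .var 0
  | n + 1 => (s n).lift

def Idx.subst (ρ : ℕ → Idx) : Idx → Idx
  | .var n => ρ n
  | .bool => .bool
  | .prod σ τ => .prod (σ.subst ρ) (τ.subst ρ)

def Ty.subst (ρ : ℕ → Idx) : Ty → Ty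
  | .basis σ => .basis (σ.subst ρ)
  | .scalar => .scalar
  | .ket σ => .ket (σ.subst ρ)
  | .bra σ => .bra (σ.subst ρ)
  | .opt σ τ => .opt (σ.subst ρ) (τ.subst ρ)
  | .arrow T U => .arrow (T.subst ρ) (U.subst ρ)
  | .all T => .all (T.subst (upIdx ρ))
  | .set σ => .set (σ.subst ρ)

/-- Simultaneous capture-avoiding substitution. -/
def Term.subst (ρ : ℕ → Idx) (s : ℕ → Term) : Term → Term
  | .var n => s n
  | .lam T t => .lam (T.subst ρ) (t.subst (upIdx ρ) (upTerm s))
  | .ilam t => .ilam (t.subst (upIdx ρ) (upTerm s))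
  | .app t u => .app (t.subst ρ s) (u.subst ρ s)
  | .iapp t σ => .iapp (t.subst ρ s) (σ.subst ρ)
  | .b0 => .b0
  | .b1 => .b1
  | .sc0 => .sc0
  | .sc1 => .sc1
  | .zeroK σ => .zeroK (σ.subst ρ)
  | .zeroB σ => .zeroB (σ.subst ρ)
  | .zeroO σ τ => .zeroO (σ.subst ρ) (τ.subst ρ)
  | .oneO σ => .oneO (σ.subst ρ)
  | .univ σ => .univ (σ.subst ρ)
  | .un o t => .un o (t.subst ρ s)
  | .bin o t u => .bin o (t.subst ρ s) (u.subst ρ s)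
  | .sum M g => .sum (M.subst ρ s) (g.subst ρ s)

/-- Replace number `0` by the index `σ` and lower all other numbers by one. -/
def instIdx (σ : Idx) : ℕ → Idx
  | 0 => σ
  | n + 1 => .var n

/-- Replace number `0` by the term `u` and lower all other numbers by one. -/
def instTerm (u : Term) : ℕ → Term
  | 0 => u
  | n + 1 => .var n

/-- `U{x/σ}`, where the index variable `x` is number `0`. -/
def Ty.inst (U : Ty) (σ : Idx) : Ty := U.subst (instIdx σ)

/-- `A{x/u}`, where the term variable `x` is number `0`.  (In a well-formed `A` the number `0` then
does not occur as an index, and the value `bool` chosen for that case plays no role.) -/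
def Term.inst (A u : Term) : Term := A.subst (instIdx .bool) (instTerm u)

/-- `A{x/σ}`, where the index variable `x` is number `0`.  (In a well-formed `A` the number `0` then
does not occur as a term; an ill-typed closed term is put there.) -/
def Term.instI (A : Term) (σ : Idx) : Term := A.subst (instIdx σ) (instTerm (.app .sc0 .sc0))

/-- `A{i/(j, k)}`, where `i` is number `0` of `A`, and `j`, `k` are numbers `1`, `0` of the result. -/
def Term.splitPair (A : Term) : Term :=
  A.subst (fun n => match n with
      | 0 => .bool
      | n + 1 => .var (n + 2))
    (fun n => match n with
      | 0 => .pair (.var 1) (.var 0)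
      | n + 1 => .var (n + 2))

/-- Exchange the numbers `0` and `1`. -/
def swapRen : ℕ → ℕ
  | 0 => 1
  | 1 => 0
  | n + 2 => n + 2

/-- Identify the number `1` with the number `0`, and lower all larger numbers by one. -/
def mergeRen : ℕ → ℕ
  | 0 => 0
  | n + 1 => n

/-! ### Contexts and typing -/

/-- Declarations `x : Index`, `x : T`, `x := t : T`. -/
inductive Entry : Type
  | idx
  | assum (T : Ty)
  | defn (t : Term) (T : Ty)

/-- Contexts; the most recent declaration, number `0`, comes first.  Each entry refers to the
declarations behind it. -/
abbrev Ctx : Type := List Entry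

/-- The types of vectors: scalars, kets, bras, operators. -/
inductive Ty.IsVec : Ty → Prop
  | scalar : Ty.IsVec .scalar
  | ket (σ : Idx) : Ty.IsVec (.ket σ)
  | bra (σ : Idx) : Ty.IsVec (.bra σ)
  | opt (σ τ : Idx) : Ty.IsVec (.opt σ τ)

/-- The types of kets, bras and operators. -/
inductive Ty.IsDirac : Ty → Prop
  | ket (σ : Idx) : Ty.IsDirac (.ket σ)
  | bra (σ : Idx) : Ty.IsDirac (.bra σ)
  | opt (σ τ : Idx) : Ty.IsDirac (.opt σ τ)

mutual

/-- Well-formed contexts. -/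
inductive WF : Ctx → Prop
  | empty : WF []
  | assumIdx {Γ : Ctx} : WF Γ → WF (.idx :: Γ)
  | assumTerm {Γ : Ctx} {T : Ty} : TyWF Γ T → WF (.assum T :: Γ)
  | defTerm {Γ : Ctx} {t : Term} {T : Ty} : HasType Γ t T → WF (.defn t T :: Γ)

/-- `Γ ⊢ σ : Index`. -/
inductive IdxWF : Ctx → Idx → Prop
  | var {Γ : Ctx} {n : ℕ} : WF Γ → Γ[n]? = some .idx → IdxWF Γ (.var n)
  | prod {Γ : Ctx} {σ τ : Idx} : IdxWF Γ σ → IdxWF Γ τ → IdxWF Γ (.prod σ τ)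
  | bool {Γ : Ctx} : WF Γ → IdxWF Γ .bool

/-- `Γ ⊢ T : Type`. -/
inductive TyWF : Ctx → Ty → Prop
  | arrow {Γ : Ctx} {T U : Ty} : TyWF Γ T → TyWF Γ U → TyWF Γ (.arrow T U)
  | all {Γ : Ctx} {U : Ty} : TyWF (.idx :: Γ) U → TyWF Γ (.all U)
  | basis {Γ : Ctx} {σ : Idx} : IdxWF Γ σ → TyWF Γ (.basis σ)
  | ket {Γ : Ctx} {σ : Idx} : IdxWF Γ σ → TyWF Γ (.ket σ)
  | bra {Γ : Ctx} {σ : Idx} : IdxWF Γ σ → TyWF Γ (.bra σ)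
  | opt {Γ : Ctx} {σ τ : Idx} : IdxWF Γ σ → IdxWF Γ τ → TyWF Γ (.opt σ τ)
  | scalar {Γ : Ctx} : WF Γ → TyWF Γ .scalar
  | set {Γ : Ctx} {σ : Idx} : IdxWF Γ σ → TyWF Γ (.set σ)

/-- `Γ ⊢ t : T`. -/
inductive HasType : Ctx → Term → Ty → Prop
  | var {Γ : Ctx} {n : ℕ} {T : Ty} : WF Γ → Γ[n]? = some (.assum T) →
      HasType Γ (.var n) (T.ren (· + (n + 1)))
  | defVar {Γ : Ctx} {n : ℕ} {t : Term} {T : Ty} : WF Γ → Γ[n]? = some (.defn t T) →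
      HasType Γ (.var n) (T.ren (· + (n + 1)))
  | lam {Γ : Ctx} {T U : Ty} {t : Term} : HasType (.assum T :: Γ) t U.lift →
      HasType Γ (.lam T t) (.arrow T U)
  | ilam {Γ : Ctx} {U : Ty} {t : Term} : HasType (.idx :: Γ) t U → HasType Γ (.ilam t) (.all U)
  | app {Γ : Ctx} {t u : Term} {T U : Ty} : HasType Γ t (.arrow U T) → HasType Γ u U →
      HasType Γ (.app t u) T
  | iapp {Γ : Ctx} {t : Term} {U : Ty} {σ : Idx} : HasType Γ t (.all U) → IdxWF Γ σ →
      HasType Γ (.iapp t σ) (U.inst σ)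
  -- basis terms
  | b0 {Γ : Ctx} : WF Γ → HasType Γ .b0 (.basis .bool)
  | b1 {Γ : Ctx} : WF Γ → HasType Γ .b1 (.basis .bool)
  | pair {Γ : Ctx} {s t : Term} {σ τ : Idx} : HasType Γ s (.basis σ) → HasType Γ t (.basis τ) →
      HasType Γ (.pair s t) (.basis (.prod σ τ))
  -- scalars
  | sc0 {Γ : Ctx} : WF Γ → HasType Γ .sc0 .scalar
  | sc1 {Γ : Ctx} : WF Γ → HasType Γ .sc1 .scalar
  | delta {Γ : Ctx} {s t : Term} {σ : Idx} : HasType Γ s (.basis σ) → HasType Γ t (.basis σ) →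
      HasType Γ (.delta s t) .scalar
  | mul {Γ : Ctx} {a b : Term} : HasType Γ a .scalar → HasType Γ b .scalar →
      HasType Γ (.mul a b) .scalar
  | conj {Γ : Ctx} {a : Term} : HasType Γ a .scalar → HasType Γ (.conj a) .scalar
  -- constants
  | zeroK {Γ : Ctx} {σ : Idx} : IdxWF Γ σ → HasType Γ (.zeroK σ) (.ket σ)
  | zeroB {Γ : Ctx} {σ : Idx} : IdxWF Γ σ → HasType Γ (.zeroB σ) (.bra σ)
  | zeroO {Γ : Ctx} {σ τ : Idx} : IdxWF Γ σ → IdxWF Γ τ → HasType Γ (.zeroO σ τ) (.opt σ τ)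
  | oneO {Γ : Ctx} {σ : Idx} : IdxWF Γ σ → HasType Γ (.oneO σ) (.opt σ σ)
  -- kets, bras, operators
  | ket {Γ : Ctx} {t : Term} {σ : Idx} : HasType Γ t (.basis σ) → HasType Γ (.ket t) (.ket σ)
  | bra {Γ : Ctx} {t : Term} {σ : Idx} : HasType Γ t (.basis σ) → HasType Γ (.bra t) (.bra σ)
  | dagB {Γ : Ctx} {B : Term} {σ : Idx} : HasType Γ B (.bra σ) → HasType Γ (.dag B) (.ket σ)
  | dagK {Γ : Ctx} {K : Term} {σ : Idx} : HasType Γ K (.ket σ) → HasType Γ (.dag K) (.bra σ)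
  | dagO {Γ : Ctx} {O : Term} {σ τ : Idx} : HasType Γ O (.opt σ τ) →
      HasType Γ (.dag O) (.opt τ σ)
  | smul {Γ : Ctx} {a D : Term} {T : Ty} : T.IsDirac → HasType Γ a .scalar → HasType Γ D T →
      HasType Γ (.smul a D) T
  | add {Γ : Ctx} {D₁ D₂ : Term} {T : Ty} : T.IsVec → HasType Γ D₁ T → HasType Γ D₂ T →
      HasType Γ (.add D₁ D₂) T
  | dotBK {Γ : Ctx} {B K : Term} {σ : Idx} : HasType Γ B (.bra σ) → HasType Γ K (.ket σ) →
      HasType Γ (.dot B K) .scalar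
  | dotOK {Γ : Ctx} {O K : Term} {σ τ : Idx} : HasType Γ O (.opt σ τ) → HasType Γ K (.ket τ) →
      HasType Γ (.dot O K) (.ket σ)
  | dotBO {Γ : Ctx} {B O : Term} {σ τ : Idx} : HasType Γ B (.bra σ) → HasType Γ O (.opt σ τ) →
      HasType Γ (.dot B O) (.bra τ)
  | dotKB {Γ : Ctx} {K B : Term} {σ τ : Idx} : HasType Γ K (.ket σ) → HasType Γ B (.bra τ) →
      HasType Γ (.dot K B) (.opt σ τ)
  | dotOO {Γ : Ctx} {O₁ O₂ : Term} {σ τ ρ : Idx} : HasType Γ O₁ (.opt σ τ) →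
      HasType Γ O₂ (.opt τ ρ) → HasType Γ (.dot O₁ O₂) (.opt σ ρ)
  | tensorK {Γ : Ctx} {K₁ K₂ : Term} {σ τ : Idx} : HasType Γ K₁ (.ket σ) → HasType Γ K₂ (.ket τ) →
      HasType Γ (.tensor K₁ K₂) (.ket (.prod σ τ))
  | tensorB {Γ : Ctx} {B₁ B₂ : Term} {σ τ : Idx} : HasType Γ B₁ (.bra σ) → HasType Γ B₂ (.bra τ) →
      HasType Γ (.tensor B₁ B₂) (.bra (.prod σ τ))
  | tensorO {Γ : Ctx} {O₁ O₂ : Term} {σ₁ τ₁ σ₂ τ₂ : Idx} : HasType Γ O₁ (.opt σ₁ τ₁) →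
      HasType Γ O₂ (.opt σ₂ τ₂) →
      HasType Γ (.tensor O₁ O₂) (.opt (.prod σ₁ σ₂) (.prod τ₁ τ₂))
  | sum {Γ : Ctx} {s f : Term} {σ : Idx} {T : Ty} : T.IsVec → HasType Γ s (.set σ) →
      HasType Γ f (.arrow (.basis σ) T) → HasType Γ (.sum s f) T
  -- sets
  | univ {Γ : Ctx} {σ : Idx} : IdxWF Γ σ → HasType Γ (.univ σ) (.set σ)
  | star {Γ : Ctx} {A B : Term} {σ τ : Idx} : HasType Γ A (.set σ) → HasType Γ B (.set τ) →
      HasType Γ (.star A B) (.set (.prod σ τ))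

end

/-! ### Semantic types -/

/-- The values of indices: finite sets (possibly empty). -/
structure FinSet : Type 1 where
  carrier : Type
  [fintype : Fintype carrier]
  [decEq : DecidableEq carrier]

attribute [instance] FinSet.fintype FinSet.decEq

instance : CoeSort FinSet Type := ⟨FinSet.carrier⟩

abbrev FinSet.bool : FinSet := ⟨Bool⟩

abbrev FinSet.prod (A B : FinSet) : FinSet := ⟨A × B⟩

/-- The Hilbert space `ℋ_A` with orthonormal basis indexed by `A`. -/
abbrev Hilb (A : FinSet) : Type := EuclideanSpace ℂ A

/-- The spaces `ℂ`, `ℋ_A`, `ℋ_A^*` and `ℒ(ℋ_B, ℋ_A)`, as codes. -/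
inductive VSort : Type 1
  | scalar
  | ket (A : FinSet)
  | bra (A : FinSet)
  | opt (A B : FinSet)

abbrev VSort.El : VSort → Type
  | .scalar => ℂ
  | .ket A => Hilb A
  | .bra A => StrongDual ℂ (Hilb A)
  | .opt A B => Hilb B →L[ℂ] Hilb A

noncomputable instance VSort.instAddCommGroup : (V : VSort) → AddCommGroup V.El
  | .scalar => inferInstanceAs (AddCommGroup ℂ)
  | .ket A => inferInstanceAs (AddCommGroup (Hilb A))
  | .bra A => inferInstanceAs (AddCommGroup (StrongDual ℂ (Hilb A)))
  | .opt A B => inferInstanceAs (AddCommGroup (Hilb B →L[ℂ] Hilb A))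

noncomputable instance VSort.instModule : (V : VSort) → Module ℂ V.El
  | .scalar => inferInstanceAs (Module ℂ ℂ)
  | .ket A => inferInstanceAs (Module ℂ (Hilb A))
  | .bra A => inferInstanceAs (Module ℂ (StrongDual ℂ (Hilb A)))
  | .opt A B => inferInstanceAs (Module ℂ (Hilb B →L[ℂ] Hilb A))

/-- Codes for the values of types without function types: a finite set, its power set, or one of the
vector spaces. -/
inductive Ground : Type 1
  | basis (A : FinSet)
  | set (A : FinSet)
  | vec (V : VSort)

abbrev Ground.El : Ground → Type
  | .basis A => A
  | .set A => Set A
  | .vec V => V.El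

/-- Codes for the values of types. -/
inductive SemTy : Type 1
  | ground (g : Ground)
  | arrow (S T : SemTy)
  | all (F : FinSet → SemTy)

/-- The set coded by a semantic type: function types are full function spaces, and `all F` is the
product of the `F X` over all finite sets `X`. -/
def SemTy.El : SemTy → Type 1
  | .ground g => ULift.{1} g.El
  | .arrow S T => S.El → T.El
  | .all F => (X : FinSet) → (F X).El

/-! ### Operations on the spaces -/

/-- The basis vector `|i⟩`. -/
noncomputable def ketOf {A : FinSet} (i : A) : Hilb A := EuclideanSpace.single i 1

/-- The basis covector `⟨i|`. -/
noncomputable def braOf {A : FinSet} (i : A) : StrongDual ℂ (Hilb A) :=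
  InnerProductSpace.toDual ℂ (Hilb A) (ketOf i)

/-- The Kronecker product of column vectors. -/
noncomputable def tensorKet {A B : FinSet} (x : Hilb A) (y : Hilb B) : Hilb (A.prod B) :=
  WithLp.toLp 2 fun p => x p.1 * y p.2

/-- The Kronecker product of row vectors. -/
noncomputable def tensorBra {A B : FinSet} (x : StrongDual ℂ (Hilb A))
    (y : StrongDual ℂ (Hilb B)) : StrongDual ℂ (Hilb (A.prod B)) :=
  ∑ p : A × B, (x (ketOf p.1) * y (ketOf p.2)) • braOf (A := A.prod B) p

/-- The Kronecker product of matrices, as operators. -/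
noncomputable def tensorOpt {A B C D : FinSet} (f : Hilb B →L[ℂ] Hilb A)
    (g : Hilb D →L[ℂ] Hilb C) : Hilb (B.prod D) →L[ℂ] Hilb (A.prod C) :=
  LinearMap.toContinuousLinearMap <| Matrix.toEuclideanLin <|
    Matrix.kronecker (Matrix.toEuclideanLin.symm f.toLinearMap)
      (Matrix.toEuclideanLin.symm g.toLinearMap)

/-- Transport along an equality of codes. -/
def VSort.cast {V W : VSort} (h : V = W) (x : V.El) : W.El := h ▸ x

/-- The meaning of the unary symbols; `none` where the symbol has no meaning. -/
noncomputable def UnOp.sem : UnOp → (g : Ground) → Option ((k : Ground) × (g.El → k.El))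
  | .conj, .vec .scalar => some ⟨.vec .scalar, fun a => starRingEnd ℂ a⟩
  | .ket, .basis A => some ⟨.vec (.ket A), fun i => ketOf i⟩
  | .bra, .basis A => some ⟨.vec (.bra A), fun i => braOf i⟩
  | .dag, .vec (.ket A) => some ⟨.vec (.bra A), fun x => InnerProductSpace.toDual ℂ (Hilb A) x⟩
  | .dag, .vec (.bra A) =>
      some ⟨.vec (.ket A), fun x => (InnerProductSpace.toDual ℂ (Hilb A)).symm x⟩
  | .dag, .vec (.opt A B) => some ⟨.vec (.opt B A), fun f => ContinuousLinearMap.adjoint f⟩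
  | _, _ => none

open Classical in
/-- The meaning of the binary symbols; `none` where the symbol has no meaning. -/
noncomputable def BinOp.sem : BinOp → (g h : Ground) → Option ((k : Ground) × (g.El → h.El → k.El))
  | .pair, .basis A, .basis B => some ⟨.basis (A.prod B), fun i j => (i, j)⟩
  | .delta, .basis A, .basis B =>
      if h : B = A then
        some ⟨.vec .scalar, fun (i : A) (j : B) => if i = (h ▸ j : A) then (1 : ℂ) else 0⟩
      else none
  | .mul, .vec .scalar, .vec .scalar => some ⟨.vec .scalar, fun (a b : ℂ) => a * b⟩
  | .smul, .vec .scalar, .vec V => some ⟨.vec V, fun (a : ℂ) (x : V.El) => a • x⟩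
  | .add, .vec V, .vec W =>
      if h : W = V then some ⟨.vec V, fun (x : V.El) (y : W.El) => x + VSort.cast h y⟩ else none
  | .tensor, .vec (.ket A), .vec (.ket B) =>
      some ⟨.vec (.ket (A.prod B)), fun x y => tensorKet x y⟩
  | .tensor, .vec (.bra A), .vec (.bra B) =>
      some ⟨.vec (.bra (A.prod B)), fun x y => tensorBra x y⟩
  | .tensor, .vec (.opt A B), .vec (.opt C D) =>
      some ⟨.vec (.opt (A.prod C) (B.prod D)), fun f g => tensorOpt f g⟩
  | .dot, .vec (.bra A), .vec (.ket B) =>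
      if h : VSort.ket B = VSort.ket A then
        some ⟨.vec .scalar, fun (x : StrongDual ℂ (Hilb A)) (y : Hilb B) =>
          x (VSort.cast (V := .ket B) (W := .ket A) h y)⟩
      else none
  | .dot, .vec (.opt A B), .vec (.ket C) =>
      if h : VSort.ket C = VSort.ket B then
        some ⟨.vec (.ket A), fun (f : Hilb B →L[ℂ] Hilb A) (y : Hilb C) =>
          f (VSort.cast (V := .ket C) (W := .ket B) h y)⟩
      else none
  | .dot, .vec (.bra A), .vec (.opt B C) =>
      if h : VSort.opt B C = VSort.opt A C then
        some ⟨.vec (.bra C), fun (x : StrongDual ℂ (Hilb A)) (f : Hilb C →L[ℂ] Hilb B) =>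
          x.comp (VSort.cast (V := .opt B C) (W := .opt A C) h f)⟩
      else none
  | .dot, .vec (.ket A), .vec (.bra B) =>
      some ⟨.vec (.opt A B), fun (x : Hilb A) (y : StrongDual ℂ (Hilb B)) =>
        ContinuousLinearMap.smulRight y x⟩
  | .dot, .vec (.opt A B), .vec (.opt C D) =>
      if h : VSort.opt C D = VSort.opt B D then
        some ⟨.vec (.opt A D), fun (f : Hilb B →L[ℂ] Hilb A) (g : Hilb D →L[ℂ] Hilb C) =>
          f.comp (VSort.cast (V := .opt C D) (W := .opt B D) h g)⟩
      else none
  | .star, .set A, .set B => some ⟨.set (A.prod B), fun (s : Set A) (t : Set B) => s ×ˢ t⟩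
  | _, _, _ => none

/-! ### Valuations and interpretation -/

/-- What a valuation assigns to a variable, without the value of a term variable: the finite set
assigned to an index variable, or the semantic type of a term variable. -/
inductive Tag : Type 1
  | idx (X : FinSet)
  | tm (S : SemTy)

/-- The values of the term variables, for given tags.  A valuation is a list `θ` of tags together
with an element of `Env θ`. -/
def Env : List Tag → Type 1
  | [] => PUnit
  | .idx _ :: θ => Env θ
  | .tm S :: θ => S.El × Env θ

/-- The interpretation of indices.  (Numbers that are not index variables never occur in
well-formed indices; they receive the value of `bool`.) -/
def Idx.interp : Idx → List Tag → FinSet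
  | .var n, θ => match θ[n]? with
      | some (.idx X) => X
      | _ => FinSet.bool
  | .bool, _ => FinSet.bool
  | .prod σ τ, θ => (σ.interp θ).prod (τ.interp θ)

/-- The interpretation of types. -/
def Ty.interp : Ty → List Tag → SemTy
  | .basis σ, θ => .ground (.basis (σ.interp θ))
  | .scalar, _ => .ground (.vec .scalar)
  | .ket σ, θ => .ground (.vec (.ket (σ.interp θ)))
  | .bra σ, θ => .ground (.vec (.bra (σ.interp θ)))
  | .opt σ τ, θ => .ground (.vec (.opt (σ.interp θ) (τ.interp θ)))
  | .arrow T U, θ => .arrow (T.interp θ) (U.interp θ)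
  | .all T, θ => .all fun X => T.interp (.idx X :: θ)
  | .set σ, θ => .ground (.set (σ.interp θ))

/-- A semantic type with a family of elements of it, one for each valuation of the term variables.
(The semantic type of a term depends only on the tags.) -/
abbrev Sem (θ : List Tag) : Type 1 := (S : SemTy) × (Env θ → S.El)

/-- The value of a variable. -/
def lookup : (θ : List Tag) → ℕ → Option (Sem θ)
  | [], _ => none
  | .idx _ :: _, 0 => none
  | .tm S :: _, 0 => some ⟨S, fun v => v.1⟩
  | .idx _ :: θ, n + 1 => (lookup θ n).map fun s => ⟨s.1, fun v => s.2 v⟩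
  | .tm _ :: θ, n + 1 => (lookup θ n).map fun s => ⟨s.1, fun v => s.2 v.2⟩

/-- A constant. -/
def Sem.const {θ : List Tag} (g : Ground) (x : g.El) : Sem θ := ⟨.ground g, fun _ => ⟨x⟩⟩

noncomputable def Sem.un {θ : List Tag} (o : UnOp) : Sem θ → Option (Sem θ)
  | ⟨.ground g, x⟩ => (o.sem g).map fun r => ⟨.ground r.1, fun v => ⟨r.2 (x v).down⟩⟩
  | _ => none

noncomputable def Sem.bin {θ : List Tag} (o : BinOp) : Sem θ → Sem θ → Option (Sem θ)
  | ⟨.ground g, x⟩, ⟨.ground h, y⟩ =>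
      (o.sem g h).map fun r => ⟨.ground r.1, fun v => ⟨r.2 (x v).down (y v).down⟩⟩
  | _, _ => none

/-- Function application. -/
noncomputable def Sem.app {θ : List Tag} : Sem θ → Sem θ → Option (Sem θ)
  | ⟨.arrow A B, f⟩, ⟨A', a⟩ =>
      open Classical in
      if h : A' = A then some ⟨B, fun v => f v (h ▸ a v)⟩ else none
  | _, _ => none

/-- Application of an index function. -/
def Sem.iapp {θ : List Tag} : Sem θ → FinSet → Option (Sem θ)
  | ⟨.all F, f⟩, X => some ⟨F X, fun v => f v X⟩
  | _, _ => none

/-- `∑_{m ∈ s} f m`. -/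
noncomputable def Sem.sum {θ : List Tag} : Sem θ → Sem θ → Option (Sem θ)
  | ⟨.ground (.set A), s⟩, ⟨.arrow (.ground (.basis A')) (.ground (.vec V)), f⟩ =>
      open Classical in
      if h : A = A' then
        some ⟨.ground (.vec V), fun v =>
          ⟨∑ m ∈ Finset.univ.filter (fun m : A => m ∈ (s v).down),
            ((f v ⟨(h ▸ m : A')⟩).down : V.El)⟩⟩
      else none
  | _, _ => none

/-- The interpretation of terms, by recursion on the term; `none` on terms without meaning. -/
noncomputable def Term.interp : Term → (θ : List Tag) → Option (Sem θ)
  | .var n, θ => lookup θ n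
  | .lam T t, θ =>
      (t.interp (.tm (T.interp θ) :: θ)).map fun s =>
        ⟨.arrow (T.interp θ) s.1, fun v a => s.2 (a, v)⟩
  | .ilam t, θ =>
      open Classical in
      if h : ∀ X : FinSet, (t.interp (.idx X :: θ)).isSome then
        some ⟨.all fun X => ((t.interp (.idx X :: θ)).get (h X)).1,
          fun v X => ((t.interp (.idx X :: θ)).get (h X)).2 v⟩
      else none
  | .app t u, θ => (t.interp θ).bind fun x => (u.interp θ).bind fun y => x.app y
  | .iapp t σ, θ => (t.interp θ).bind fun x => x.iapp (σ.interp θ)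
  | .b0, _ => some (.const (.basis FinSet.bool) false)
  | .b1, _ => some (.const (.basis FinSet.bool) true)
  | .sc0, _ => some (.const (.vec .scalar) (0 : ℂ))
  | .sc1, _ => some (.const (.vec .scalar) (1 : ℂ))
  | .zeroK σ, θ => some (.const (.vec (.ket (σ.interp θ))) (0 : Hilb (σ.interp θ)))
  | .zeroB σ, θ => some (.const (.vec (.bra (σ.interp θ))) (0 : StrongDual ℂ (Hilb (σ.interp θ))))
  | .zeroO σ τ, θ => some (.const (.vec (.opt (σ.interp θ) (τ.interp θ)))
      (0 : Hilb (τ.interp θ) →L[ℂ] Hilb (σ.interp θ)))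
  | .oneO σ, θ => some (.const (.vec (.opt (σ.interp θ) (σ.interp θ)))
      (ContinuousLinearMap.id ℂ (Hilb (σ.interp θ))))
  | .univ σ, θ => some (.const (.set (σ.interp θ)) (Set.univ : Set (σ.interp θ)))
  | .un o t, θ => (t.interp θ).bind fun x => x.un o
  | .bin o t u, θ => (t.interp θ).bind fun x => (u.interp θ).bind fun y => x.bin o y
  | .sum s f, θ => (s.interp θ).bind fun x => (f.interp θ).bind fun y => x.sum y

/-- The denotation `⟦t⟧_v` of a term under a valuation: an element of some semantic type. -/
noncomputable def Term.eval (t : Term) (θ : List Tag) (v : Env θ) : Option ((S : SemTy) × S.El) :=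
  (t.interp θ).map fun s => ⟨s.1, s.2 v⟩

/-- The valuation `(θ, v)` is valid for the context: it gives a finite set to each `x : Index`, an
element of `⟦T⟧_v` to each `x : T`, and the value `⟦t⟧_v` to each `x := t : T`. -/
def ValidFor : Ctx → (θ : List Tag) → Env θ → Prop
  | [], [], _ => True
  | .idx :: Γ, .idx _ :: θ, v => ValidFor Γ θ v
  | .assum T :: Γ, .tm S :: θ, v => S = T.interp θ ∧ ValidFor Γ θ v.2
  | .defn t _ :: Γ, .tm S :: θ, v => t.eval θ v.2 = some ⟨S, v.1⟩ ∧ ValidFor Γ θ v.2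
  | _, _, _ => False

/-! ### The equational theory -/

/-- Hypotheses `s ≠ t` about basis terms. -/
abbrev Hyps : Type := List (Term × Term)

def Hyps.lift (Φ : Hyps) : Hyps := Φ.map fun p => (p.1.lift, p.2.lift)

/-- The zero constants. -/
inductive IsZero : Term → Prop
  | scalar : IsZero .sc0
  | ket (σ : Idx) : IsZero (.zeroK σ)
  | bra (σ : Idx) : IsZero (.zeroB σ)
  | opt (σ τ : Idx) : IsZero (.zeroO σ τ)

open Term in
/-- The axioms.  They are schemes over untyped terms; only those instances are used, both sides of
which have one and the same type (see `Derivable`).  `A.lift` under a binder says that the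
bound variable does not occur in `A`. -/
inductive Ax (Γ : Ctx) (Φ : Hyps) : Term → Term → Prop
  -- scalars
  | conj_dot (B K : Term) : Ax Γ Φ (conj (dot B K)) (dot (dag K) (dag B))
  | mul_comm (a b : Term) : Ax Γ Φ (mul a b) (mul b a)
  | mul_assoc (a b c : Term) : Ax Γ Φ (mul (mul a b) c) (mul a (mul b c))
  | one_mul (a : Term) : Ax Γ Φ (mul sc1 a) a
  | zero_mul (a : Term) : Ax Γ Φ (mul sc0 a) sc0
  | mul_add (a b c : Term) : Ax Γ Φ (mul a (add b c)) (add (mul a b) (mul a c))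
  | conj_zero : Ax Γ Φ (conj sc0) sc0
  | conj_one : Ax Γ Φ (conj sc1) sc1
  | conj_add (a b : Term) : Ax Γ Φ (conj (add a b)) (add (conj a) (conj b))
  | conj_mul (a b : Term) : Ax Γ Φ (conj (mul a b)) (mul (conj a) (conj b))
  | conj_conj (a : Term) : Ax Γ Φ (conj (conj a)) a
  -- delta
  | conj_delta (s t : Term) : Ax Γ Φ (conj (delta s t)) (delta s t)
  | bra_dot_ket (s t : Term) : Ax Γ Φ (dot (bra s) (ket t)) (delta s t)
  | delta_self (s : Term) : Ax Γ Φ (delta s s) sc1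
  | delta_ne (s t : Term) : (s, t) ∈ Φ → Ax Γ Φ (delta s t) sc0
  | delta_comm (s t : Term) : Ax Γ Φ (delta s t) (delta t s)
  -- linearity
  | zero_add (z D : Term) : IsZero z → Ax Γ Φ (add z D) D
  | add_comm (D₁ D₂ : Term) : Ax Γ Φ (add D₁ D₂) (add D₂ D₁)
  | add_assoc (D₁ D₂ D₃ : Term) : Ax Γ Φ (add (add D₁ D₂) D₃) (add D₁ (add D₂ D₃))
  | zero_smul (D z : Term) : IsZero z → Ax Γ Φ (smul sc0 D) z
  | smul_zero (a z : Term) : IsZero z → Ax Γ Φ (smul a z) z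
  | one_smul (D : Term) : Ax Γ Φ (smul sc1 D) D
  | smul_smul (a b D : Term) : Ax Γ Φ (smul a (smul b D)) (smul (mul a b) D)
  | add_smul (a b D : Term) : Ax Γ Φ (smul (add a b) D) (add (smul a D) (smul b D))
  | smul_add (a D₁ D₂ : Term) : Ax Γ Φ (smul a (add D₁ D₂)) (add (smul a D₁) (smul a D₂))
  -- bilinearity of the dot product; for a scalar value, scaling is the product of scalars
  | dot_zero (D z z' : Term) : IsZero z → IsZero z' → Ax Γ Φ (dot D z) z'
  | dot_smul (a D₁ D₂ : Term) : Ax Γ Φ (dot D₁ (smul a D₂)) (smul a (dot D₁ D₂))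
  | dot_smul_scalar (a B K : Term) : Ax Γ Φ (dot B (smul a K)) (mul a (dot B K))
  | dot_add (D₀ D₁ D₂ : Term) : Ax Γ Φ (dot D₀ (add D₁ D₂)) (add (dot D₀ D₁) (dot D₀ D₂))
  | zero_dot (D z z' : Term) : IsZero z → IsZero z' → Ax Γ Φ (dot z D) z'
  | smul_dot (a D₁ D₂ : Term) : Ax Γ Φ (dot (smul a D₁) D₂) (smul a (dot D₁ D₂))
  | smul_dot_scalar (a B K : Term) : Ax Γ Φ (dot (smul a B) K) (mul a (dot B K))
  | add_dot (D₀ D₁ D₂ : Term) : Ax Γ Φ (dot (add D₁ D₂) D₀) (add (dot D₁ D₀) (dot D₂ D₀))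
  -- bilinearity of the tensor product
  | tensor_zero (D z z' : Term) : IsZero z → IsZero z' → Ax Γ Φ (tensor D z) z'
  | tensor_smul (a D₁ D₂ : Term) : Ax Γ Φ (tensor D₁ (smul a D₂)) (smul a (tensor D₁ D₂))
  | tensor_add (D₀ D₁ D₂ : Term) :
      Ax Γ Φ (tensor D₀ (add D₁ D₂)) (add (tensor D₀ D₁) (tensor D₀ D₂))
  | zero_tensor (D z z' : Term) : IsZero z → IsZero z' → Ax Γ Φ (tensor z D) z'
  | smul_tensor (a D₁ D₂ : Term) : Ax Γ Φ (tensor (smul a D₁) D₂) (smul a (tensor D₁ D₂))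
  | add_tensor (D₀ D₁ D₂ : Term) :
      Ax Γ Φ (tensor (add D₁ D₂) D₀) (add (tensor D₁ D₀) (tensor D₂ D₀))
  -- adjoint
  | dag_zero (z z' : Term) : IsZero z → IsZero z' → Ax Γ Φ (dag z) z'
  | dag_dag (D : Term) : Ax Γ Φ (dag (dag D)) D
  | dag_smul (a D : Term) : Ax Γ Φ (dag (smul a D)) (smul (conj a) (dag D))
  | dag_add (D₁ D₂ : Term) : Ax Γ Φ (dag (add D₁ D₂)) (add (dag D₁) (dag D₂))
  | dag_dot (D₁ D₂ : Term) : Ax Γ Φ (dag (dot D₁ D₂)) (dot (dag D₂) (dag D₁))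
  | dag_tensor (D₁ D₂ : Term) : Ax Γ Φ (dag (tensor D₁ D₂)) (tensor (dag D₁) (dag D₂))
  -- composition
  | dot_assoc (D₀ D₁ D₂ : Term) : Ax Γ Φ (dot D₀ (dot D₁ D₂)) (dot (dot D₀ D₁) D₂)
  | tensor_dot_tensor (D₁ D₂ D₃ D₄ : Term) :
      Ax Γ Φ (dot (tensor D₁ D₂) (tensor D₃ D₄)) (tensor (dot D₁ D₃) (dot D₂ D₄))
  | outer_dot (K₁ B K₂ : Term) : Ax Γ Φ (dot (dot K₁ B) K₂) (smul (dot B K₂) K₁)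
  | dot_outer (B₁ K B₂ : Term) : Ax Γ Φ (dot B₁ (dot K B₂)) (smul (dot B₁ K) B₂)
  | tensor_dot_tensor_scalar (B₁ B₂ K₁ K₂ : Term) :
      Ax Γ Φ (dot (tensor B₁ B₂) (tensor K₁ K₂)) (mul (dot B₁ K₁) (dot B₂ K₂))
  -- ground terms
  | dag_one (σ : Idx) : Ax Γ Φ (dag (oneO σ)) (oneO σ)
  | one_dot (σ : Idx) (D : Term) : Ax Γ Φ (dot (oneO σ) D) D
  | one_tensor_one (σ τ : Idx) : Ax Γ Φ (tensor (oneO σ) (oneO τ)) (oneO (.prod σ τ))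
  | dag_ket (t : Term) : Ax Γ Φ (dag (ket t)) (bra t)
  | ket_tensor_ket (s t : Term) : Ax Γ Φ (tensor (ket s) (ket t)) (ket (pair s t))
  -- sums
  | sum_zero (M : Term) (T : Ty) (z z' : Term) : IsZero z → IsZero z' → Ax Γ Φ (bsum M T z) z'
  | sum_outer (σ : Idx) :
      Ax Γ Φ (bsum (univ σ) (.basis σ) (dot (ket (var 0)) (bra (var 0)))) (oneO σ)
  | sum_delta (σ : Idx) (T : Ty) (t : Term) :
      Ax Γ Φ (bsum (univ σ) T (delta (var 0) t.lift)) sc1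
  | sum_delta_smul (σ : Idx) (T : Ty) (t A : Term) :
      Ax Γ Φ (bsum (univ σ) T (smul (delta (var 0) t.lift) A)) (A.inst t)
  | sum_delta_mul (σ : Idx) (T : Ty) (t a : Term) :
      Ax Γ Φ (bsum (univ σ) T (mul (delta (var 0) t.lift) a)) (a.inst t)
  | sum_sum_delta (M : Term) (T : Ty) :
      Ax Γ Φ (bsum M T (bsum M.lift T.lift (delta (var 1) (var 0)))) (bsum M T sc1)
  | sum_sum_delta_smul (M : Term) (T : Ty) (A : Term) :
      Ax Γ Φ (bsum M T (bsum M.lift T.lift (smul (delta (var 1) (var 0)) A)))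
        (bsum M T (A.ren mergeRen))
  | sum_sum_delta_mul (M : Term) (T : Ty) (a : Term) :
      Ax Γ Φ (bsum M T (bsum M.lift T.lift (mul (delta (var 1) (var 0)) a)))
        (bsum M T (a.ren mergeRen))
  | mul_sum (b M : Term) (T : Ty) (a : Term) :
      Ax Γ Φ (mul b (bsum M T a)) (bsum M T (mul b.lift a))
  | conj_sum (M : Term) (T : Ty) (a : Term) : Ax Γ Φ (conj (bsum M T a)) (bsum M T (conj a))
  | dag_sum (M : Term) (T : Ty) (A : Term) : Ax Γ Φ (dag (bsum M T A)) (bsum M T (dag A))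
  | smul_sum (a M : Term) (T : Ty) (A : Term) :
      Ax Γ Φ (smul a (bsum M T A)) (bsum M T (smul a.lift A))
  | sum_smul (M : Term) (T : Ty) (a A : Term) :
      Ax Γ Φ (smul (bsum M T a) A) (bsum M T (smul a A.lift))
  | dot_sum (X M : Term) (T : Ty) (Y : Term) :
      Ax Γ Φ (dot X (bsum M T Y)) (bsum M T (dot X.lift Y))
  | sum_dot (M : Term) (T : Ty) (X Y : Term) :
      Ax Γ Φ (dot (bsum M T X) Y) (bsum M T (dot X Y.lift))
  | tensor_sum (X M : Term) (T : Ty) (Y : Term) :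
      Ax Γ Φ (tensor X (bsum M T Y)) (bsum M T (tensor X.lift Y))
  | sum_tensor (M : Term) (T : Ty) (X Y : Term) :
      Ax Γ Φ (tensor (bsum M T X) Y) (bsum M T (tensor X Y.lift))
  | sum_add (M : Term) (T : Ty) (X₁ X₂ : Term) :
      Ax Γ Φ (bsum M T (add X₁ X₂)) (add (bsum M T X₁) (bsum M T X₂))
  | sum_univ_prod (σ τ : Idx) (T : Ty) (A : Term) :
      Ax Γ Φ (bsum (univ (.prod σ τ)) T A)
        (bsum (univ σ) (.basis σ) (bsum (univ τ).lift (Ty.basis τ).lift A.splitPair))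
  | sum_star (M₁ M₂ : Term) (T T₁ T₂ : Ty) (A : Term) :
      Ax Γ Φ (bsum (star M₁ M₂) T A) (bsum M₁ T₁ (bsum M₂.lift T₂.lift A.splitPair))
  | sum_swap (M₁ M₂ : Term) (T₁ T₂ : Ty) (A : Term) :
      Ax Γ Φ (bsum M₁ T₁ (bsum M₂.lift T₂.lift A))
        (bsum M₂ T₂ (bsum M₁.lift T₁.lift (A.ren swapRen)))
  -- sets
  | univ_star_univ (σ τ : Idx) : Ax Γ Φ (star (univ σ) (univ τ)) (univ (.prod σ τ))
  -- the index `bool`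
  | delta_b0_b1 : Ax Γ Φ (delta b0 b1) sc0
  | sum_bool (T : Ty) (A : Term) :
      Ax Γ Φ (bsum (univ .bool) T A) (add (A.inst b0) (A.inst b1))
  -- functions and definitions
  | beta (T : Ty) (t u : Term) : Ax Γ Φ (app (lam T t) u) (t.inst u)
  | beta_idx (t : Term) (σ : Idx) : Ax Γ Φ (iapp (ilam t) σ) (t.instI σ)
  | unfold (n : ℕ) (t : Term) (T : Ty) : Γ[n]? = some (.defn t T) →
      Ax Γ Φ (var n) (t.ren (· + (n + 1)))

/-- `Γ ⊢ e₁ = e₂ : T` under the hypotheses `Φ`: typed equational logic over the axioms.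
α-equivalent terms are equal as nameless terms, so that the rule `λ x. A = λ y. A{x/y}` is an instance
of `refl`. -/
inductive Derivable : Ctx → Hyps → Term → Term → Ty → Prop
  | ax {Γ : Ctx} {Φ : Hyps} {e₁ e₂ : Term} {T : Ty} : Ax Γ Φ e₁ e₂ → HasType Γ e₁ T →
      HasType Γ e₂ T → Derivable Γ Φ e₁ e₂ T
  | refl {Γ : Ctx} {Φ : Hyps} {e : Term} {T : Ty} : HasType Γ e T → Derivable Γ Φ e e T
  | symm {Γ : Ctx} {Φ : Hyps} {e₁ e₂ : Term} {T : Ty} : Derivable Γ Φ e₁ e₂ T →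
      Derivable Γ Φ e₂ e₁ T
  | trans {Γ : Ctx} {Φ : Hyps} {e₁ e₂ e₃ : Term} {T : Ty} : Derivable Γ Φ e₁ e₂ T →
      Derivable Γ Φ e₂ e₃ T → Derivable Γ Φ e₁ e₃ T
  | lam {Γ : Ctx} {Φ : Hyps} {T U : Ty} {t t' : Term} :
      Derivable (.assum T :: Γ) Φ.lift t t' U.lift →
      Derivable Γ Φ (.lam T t) (.lam T t') (.arrow T U)
  | ilam {Γ : Ctx} {Φ : Hyps} {U : Ty} {t t' : Term} :
      Derivable (.idx :: Γ) Φ.lift t t' U → Derivable Γ Φ (.ilam t) (.ilam t') (.all U)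
  | app {Γ : Ctx} {Φ : Hyps} {t t' u u' : Term} {T U : Ty} : Derivable Γ Φ t t' (.arrow U T) →
      Derivable Γ Φ u u' U → Derivable Γ Φ (.app t u) (.app t' u') T
  | iapp {Γ : Ctx} {Φ : Hyps} {t t' : Term} {U : Ty} {σ : Idx} : Derivable Γ Φ t t' (.all U) →
      IdxWF Γ σ → Derivable Γ Φ (.iapp t σ) (.iapp t' σ) (U.inst σ)
  | un {Γ : Ctx} {Φ : Hyps} (o : UnOp) {t t' : Term} {U T : Ty} : Derivable Γ Φ t t' U →
      HasType Γ (.un o t) T → HasType Γ (.un o t') T → Derivable Γ Φ (.un o t) (.un o t') T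
  | bin {Γ : Ctx} {Φ : Hyps} (o : BinOp) {t t' u u' : Term} {U₁ U₂ T : Ty} :
      Derivable Γ Φ t t' U₁ → Derivable Γ Φ u u' U₂ →
      HasType Γ (.bin o t u) T → HasType Γ (.bin o t' u') T →
      Derivable Γ Φ (.bin o t u) (.bin o t' u') T
  | sum {Γ : Ctx} {Φ : Hyps} {s s' f f' : Term} {U₁ U₂ T : Ty} :
      Derivable Γ Φ s s' U₁ → Derivable Γ Φ f f' U₂ →
      HasType Γ (.sum s f) T → HasType Γ (.sum s' f') T →
      Derivable Γ Φ (.sum s f) (.sum s' f') T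

/-- The valuation satisfies the hypotheses `s ≠ t`. -/
def Satisfies (Φ : Hyps) (θ : List Tag) (v : Env θ) : Prop :=
  ∀ p ∈ Φ, p.1.eval θ v ≠ p.2.eval θ v

/-- `Γ ⊨ e₁ = e₂` under the hypotheses `Φ`: for all valuations valid for `Γ` that satisfy `Φ`,
both sides have a denotation, and it is the same element of `⟦T⟧_v`. -/
def Valid (Γ : Ctx) (Φ : Hyps) (e₁ e₂ : Term) (T : Ty) : Prop :=
  ∀ (θ : List Tag) (v : Env θ), ValidFor Γ θ v → Satisfies Φ θ v →
    ∃ d : (T.interp θ).El,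
      e₁.eval θ v = some ⟨T.interp θ, d⟩ ∧ e₂.eval θ v = some ⟨T.interp θ, d⟩

end Dirac

/-!
# Soundness of the equational theory of plain Dirac notation

The interpretation is compositional, so the congruence rules preserve equality of values, and it
remains to verify the axioms.  Three facts make this manageable.

* *Substitution is composition.*  A renaming or substitution of variables acts on the interpretation
  of a term by a map of valuations (`Term.interp_ren`, `Term.interp_subst`).  This needs no typing.
  It settles the β-rules and the side conditions on bound variables: a weakened term has the same
  value for every value of the new variable (`Term.eval_lift_push`), and `A{i/t}`, `A{i/(j, k)}` and
  the exchange of two summation variables become changes of the valuation.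

* *Typing is sound* (`HasType.interp`).  This is proved for the tags of a valuation alone, without
  the values of the variables: the body of `λ x : T. t` must have a semantic type even if `T` has no
  elements.  It follows that both sides of an axiom have values of one and the same semantic type.

* *The operations are linear.*  Whenever `×`, scaling, `⊗` or `·` has a value, it is given there by
  a bilinear map (`BinRel.bilin`), and `*` and `†` are given by conjugate-linear maps
  (`UnRel.conjLin`).  Hence distributivity, homogeneity, the laws for zero and the exchange of an
  operation with a sum are proved once for all operations and all kinds of vectors.

The other axioms are identities between kets, bras and operators.  Since linear maps on `ℋ_{A × B}`
are determined by their values on product kets (`clm_ext_tensor`), the identities on Kronecker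
products reduce to those values.  `Ax.eval_eq` collects the axioms.  It assumes that both sides have
values of one type, as some axioms identify zeros whose space only the type can determine; the same
is true of sums over empty sets.
-/

namespace Dirac

/-! ### Renaming and substitution in the semantics -/

/-- Reindexing of a family of values along a map of valuations. -/
def Sem.pre {θ' θ : List Tag} (m : Env θ' → Env θ) (s : Sem θ) : Sem θ' :=
  ⟨s.1, fun v => s.2 (m v)⟩

/-- The map of valuations that forgets the most recent variable. -/
def Env.tail : (g : Tag) → {θ : List Tag} → Env (g :: θ) → Env θ
  | .idx _, _, v => v
  | .tm _, _, v => v.2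

/-- A map of valuations, pushed under a binder. -/
def Env.up : (g : Tag) → {θ' θ : List Tag} → (Env θ' → Env θ) → Env (g :: θ') → Env (g :: θ)
  | .idx _, _, _, m, v => m v
  | .tm _, _, _, m, v => (v.1, m v.2)

theorem lookup_succ (g : Tag) (θ : List Tag) (n : ℕ) :
    lookup (g :: θ) (n + 1) = (lookup θ n).map (Sem.pre (Env.tail g)) := by
  cases g <;> rfl

theorem lookup_zero_up (g : Tag) {θ' θ : List Tag} (m : Env θ' → Env θ) :
    lookup (g :: θ') 0 = (lookup (g :: θ) 0).map (Sem.pre (Env.up g m)) := by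
  cases g <;> rfl

theorem map_pre_pre {θ₁ θ₂ θ₃ : List Tag} (m : Env θ₁ → Env θ₂) (k : Env θ₂ → Env θ₃)
    (x : Option (Sem θ₃)) :
    (x.map (Sem.pre k)).map (Sem.pre m) = x.map (Sem.pre fun v => k (m v)) := by
  cases x <;> rfl

theorem tail_up (g : Tag) {θ' θ : List Tag} (m : Env θ' → Env θ) (v : Env (g :: θ')) :
    Env.tail g (Env.up g m v) = m (Env.tail g v) := by
  cases g <;> rfl

/-- The interpretation of an abstraction over an index variable, from the interpretations of its
body. -/
noncomputable def Sem.all {θ : List Tag} (F : (X : FinSet) → Option (Sem (.idx X :: θ))) :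
    Option (Sem θ) :=
  open Classical in
  if h : ∀ X : FinSet, (F X).isSome then
    some ⟨.all fun X => ((F X).get (h X)).1, fun v X => ((F X).get (h X)).2 v⟩
  else none

theorem Sem.all_pre {θ' θ : List Tag} (m : Env θ' → Env θ)
    (F : (X : FinSet) → Option (Sem (.idx X :: θ))) :
    Sem.all (fun X => (F X).map (Sem.pre (Env.up (.idx X) m))) =
      (Sem.all F).map (Sem.pre m) := by
  unfold Sem.all
  by_cases h : ∀ X : FinSet, (F X).isSome
  · choose G hG using fun X => Option.isSome_iff_exists.mp (h X)
    obtain rfl : F = fun X => some (G X) := funext hG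
    simp [Sem.pre, Env.up]
  · simp [h]

theorem Sem.un_pre {θ' θ : List Tag} (m : Env θ' → Env θ) (o : UnOp) (x : Sem θ) :
    (x.pre m).un o = (x.un o).map (Sem.pre m) := by
  obtain ⟨S, f⟩ := x
  cases S with
  | ground g => simp only [Sem.pre, Sem.un]; cases o.sem g <;> rfl
  | _ => rfl

theorem Sem.bin_pre {θ' θ : List Tag} (m : Env θ' → Env θ) (o : BinOp) (x y : Sem θ) :
    (x.pre m).bin o (y.pre m) = (x.bin o y).map (Sem.pre m) := by
  obtain ⟨S, f⟩ := x
  obtain ⟨T, g⟩ := y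
  cases S <;> cases T <;> try rfl
  rename_i G H
  simp only [Sem.pre, Sem.bin]; cases o.sem G H <;> rfl

theorem Sem.app_pre {θ' θ : List Tag} (m : Env θ' → Env θ) (x y : Sem θ) :
    (x.pre m).app (y.pre m) = (x.app y).map (Sem.pre m) := by
  obtain ⟨S, f⟩ := x
  obtain ⟨T, g⟩ := y
  cases S with
  | arrow A B =>
    simp only [Sem.pre, Sem.app]
    by_cases h : T = A <;> simp [h, Sem.pre]
  | _ => rfl

theorem Sem.iapp_pre {θ' θ : List Tag} (m : Env θ' → Env θ) (x : Sem θ) (X : FinSet) :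
    (x.pre m).iapp X = (x.iapp X).map (Sem.pre m) := by
  obtain ⟨S, f⟩ := x
  cases S <;> rfl

theorem Sem.sum_pre {θ' θ : List Tag} (m : Env θ' → Env θ) (x y : Sem θ) :
    (x.pre m).sum (y.pre m) = (x.sum y).map (Sem.pre m) := by
  obtain ⟨S, f⟩ := x
  obtain ⟨T, g⟩ := y
  unfold Sem.sum
  split
  · rename_i A s A' V f heq heq'
    cases heq
    cases heq'
    by_cases h : A = A' <;> simp [h, Sem.pre]
  · rename_i hn
    split
    · rename_i A s A' V f heq heq'
      cases heq
      cases heq'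
      exact (hn _ _ _ _ _ rfl rfl).elim
    · rfl

/-- The renaming `f` describes the map `m` of valuations. -/
structure RenOk (f : ℕ → ℕ) {θ' θ : List Tag} (m : Env θ' → Env θ) : Prop where
  idx : ∀ n, (Idx.var (f n)).interp θ' = (Idx.var n).interp θ
  tm : ∀ n, lookup θ' (f n) = (lookup θ n).map (Sem.pre m)

/-- The substitutions `ρ` of indices and `s` of terms describe the map `m` of valuations. -/
structure SubstOk (ρ : ℕ → Idx) (s : ℕ → Term) {θ' θ : List Tag} (m : Env θ' → Env θ) :
    Prop where
  idx : ∀ n, (ρ n).interp θ' = (Idx.var n).interp θ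
  tm : ∀ n, (s n).interp θ' = (lookup θ n).map (Sem.pre m)

theorem interp_upRen {f : ℕ → ℕ} {θ' θ : List Tag}
    (h : ∀ n, (Idx.var (f n)).interp θ' = (Idx.var n).interp θ) (g : Tag) (n : ℕ) :
    (Idx.var (upRen f n)).interp (g :: θ') = (Idx.var n).interp (g :: θ) := by
  cases n with
  | zero => rfl
  | succ n => simpa [Idx.interp, upRen] using h n

theorem Idx.interp_ren {f : ℕ → ℕ} {θ' θ : List Tag}
    (h : ∀ n, (Idx.var (f n)).interp θ' = (Idx.var n).interp θ) (σ : Idx) :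
    (σ.ren f).interp θ' = σ.interp θ := by
  induction σ with
  | var n => exact h n
  | bool => rfl
  | prod σ τ h₁ h₂ => simp only [Idx.ren, Idx.interp, h₁, h₂]

theorem Ty.interp_ren {f : ℕ → ℕ} {θ' θ : List Tag}
    (h : ∀ n, (Idx.var (f n)).interp θ' = (Idx.var n).interp θ) (T : Ty) :
    (T.ren f).interp θ' = T.interp θ := by
  induction T generalizing f θ' θ with
  | arrow T U h₁ h₂ => simp only [Ty.ren, Ty.interp, h₁ h, h₂ h]
  | all T ih => simp only [Ty.ren, Ty.interp, fun X => ih (interp_upRen h (.idx X))]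
  | _ => simp only [Ty.ren, Ty.interp, Idx.interp_ren h]

theorem RenOk.up {f : ℕ → ℕ} {θ' θ : List Tag} {m : Env θ' → Env θ} (h : RenOk f m) (g : Tag) :
    RenOk (upRen f) (Env.up g m) where
  idx := interp_upRen h.idx g
  tm n := by
    cases n with
    | zero => exact lookup_zero_up g m
    | succ n =>
      simp only [upRen, lookup_succ, h.tm, map_pre_pre, tail_up]

theorem RenOk.comp {f k : ℕ → ℕ} {θ₁ θ₂ θ₃ : List Tag} {m : Env θ₁ → Env θ₂}
    {l : Env θ₂ → Env θ₃} (h : RenOk f m) (h' : RenOk k l) :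
    RenOk (fun n => f (k n)) (fun v => l (m v)) where
  idx n := (h.idx _).trans (h'.idx n)
  tm n := by rw [h.tm, h'.tm, map_pre_pre]

theorem RenOk.succ (g : Tag) (θ : List Tag) : RenOk Nat.succ (Env.tail g (θ := θ)) where
  idx _ := by simp [Idx.interp]
  tm n := lookup_succ g θ n

theorem Term.interp_ren {f : ℕ → ℕ} {θ' θ : List Tag} {m : Env θ' → Env θ} (h : RenOk f m)
    (t : Term) : (t.ren f).interp θ' = (t.interp θ).map (Sem.pre m) := by
  induction t generalizing f θ' θ with
  | var n => exact h.tm n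
  | lam T t ih =>
    simp only [Term.ren, Term.interp]
    rw [Ty.interp_ren h.idx T, ih (h.up _)]
    cases t.interp (.tm (T.interp θ) :: θ) <;> rfl
  | ilam t ih =>
    change Sem.all (fun X => (t.ren (upRen f)).interp (.idx X :: θ')) =
      (Sem.all fun X => t.interp (.idx X :: θ)).map (Sem.pre m)
    rw [← Sem.all_pre]
    exact congrArg _ (funext fun X => ih (h.up _))
  | app t u h₁ h₂ =>
    simp only [Term.ren, Term.interp, h₁ h, h₂ h]
    cases t.interp θ <;> cases u.interp θ <;> first | rfl | exact Sem.app_pre m _ _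
  | iapp t σ ih =>
    simp only [Term.ren, Term.interp, ih h, Idx.interp_ren h.idx]
    cases t.interp θ <;> first | rfl | exact Sem.iapp_pre m _ _
  | un o t ih =>
    simp only [Term.ren, Term.interp, ih h]
    cases t.interp θ <;> first | rfl | exact Sem.un_pre m _ _
  | bin o t u h₁ h₂ =>
    simp only [Term.ren, Term.interp, h₁ h, h₂ h]
    cases t.interp θ <;> cases u.interp θ <;> first | rfl | exact Sem.bin_pre m _ _ _
  | sum t u h₁ h₂ =>
    simp only [Term.ren, Term.interp, h₁ h, h₂ h]
    cases t.interp θ <;> cases u.interp θ <;> first | rfl | exact Sem.sum_pre m _ _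
  | zeroO σ τ =>
    simp only [Term.ren, Term.interp]
    rw [Idx.interp_ren h.idx σ, Idx.interp_ren h.idx τ]
    rfl
  | zeroK σ | zeroB σ | oneO σ | univ σ =>
    simp only [Term.ren, Term.interp]
    rw [Idx.interp_ren h.idx σ]
    rfl
  | b0 | b1 | sc0 | sc1 => rfl

theorem Term.interp_lift (g : Tag) (θ : List Tag) (t : Term) :
    t.lift.interp (g :: θ) = (t.interp θ).map (Sem.pre (Env.tail g)) :=
  t.interp_ren (.succ g θ)

/-- The semantic type does not depend on a variable that does not occur. -/
theorem Ty.interp_lift (g : Tag) (θ : List Tag) (T : Ty) :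
    T.lift.interp (g :: θ) = T.interp θ :=
  T.interp_ren fun _ => by simp [Idx.interp]

theorem interp_upIdx {ρ : ℕ → Idx} {θ' θ : List Tag}
    (h : ∀ n, (ρ n).interp θ' = (Idx.var n).interp θ) (g : Tag) (n : ℕ) :
    (upIdx ρ n).interp (g :: θ') = (Idx.var n).interp (g :: θ) := by
  cases n with
  | zero => rfl
  | succ n =>
    simp only [upIdx]
    rw [Idx.interp_ren (RenOk.succ g θ').idx, h]
    simp [Idx.interp]

theorem Idx.interp_subst {ρ : ℕ → Idx} {θ' θ : List Tag}
    (h : ∀ n, (ρ n).interp θ' = (Idx.var n).interp θ) (σ : Idx) :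
    (σ.subst ρ).interp θ' = σ.interp θ := by
  induction σ with
  | var n => exact h n
  | bool => rfl
  | prod σ τ h₁ h₂ => simp only [Idx.subst, Idx.interp, h₁, h₂]

theorem Ty.interp_subst {ρ : ℕ → Idx} {θ' θ : List Tag}
    (h : ∀ n, (ρ n).interp θ' = (Idx.var n).interp θ) (T : Ty) :
    (T.subst ρ).interp θ' = T.interp θ := by
  induction T generalizing ρ θ' θ with
  | arrow T U h₁ h₂ => simp only [Ty.subst, Ty.interp, h₁ h, h₂ h]
  | all T ih => simp only [Ty.subst, Ty.interp, fun X => ih (interp_upIdx h (.idx X))]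
  | _ => simp only [Ty.subst, Ty.interp, Idx.interp_subst h]

theorem SubstOk.up {ρ : ℕ → Idx} {s : ℕ → Term} {θ' θ : List Tag} {m : Env θ' → Env θ}
    (h : SubstOk ρ s m) (g : Tag) : SubstOk (upIdx ρ) (upTerm s) (Env.up g m) where
  idx := interp_upIdx h.idx g
  tm n := by
    cases n with
    | zero => exact lookup_zero_up g m
    | succ n =>
      simp only [upTerm, Term.interp_lift, lookup_succ, h.tm, map_pre_pre, tail_up]

/-- The substitution lemma.  It needs no typing: the junk values of untyped terms are those of the
substitutions used in the axioms. -/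
theorem Term.interp_subst {ρ : ℕ → Idx} {s : ℕ → Term} {θ' θ : List Tag} {m : Env θ' → Env θ}
    (h : SubstOk ρ s m) (t : Term) :
    (t.subst ρ s).interp θ' = (t.interp θ).map (Sem.pre m) := by
  induction t generalizing ρ s θ' θ with
  | var n => exact h.tm n
  | lam T t ih =>
    simp only [Term.subst, Term.interp]
    rw [Ty.interp_subst h.idx T, ih (h.up _)]
    cases t.interp (.tm (T.interp θ) :: θ) <;> rfl
  | ilam t ih =>
    change Sem.all (fun X => (t.subst (upIdx ρ) (upTerm s)).interp (.idx X :: θ')) =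
      (Sem.all fun X => t.interp (.idx X :: θ)).map (Sem.pre m)
    rw [← Sem.all_pre]
    exact congrArg _ (funext fun X => ih (h.up _))
  | app t u h₁ h₂ =>
    simp only [Term.subst, Term.interp, h₁ h, h₂ h]
    cases t.interp θ <;> cases u.interp θ <;> first | rfl | exact Sem.app_pre m _ _
  | iapp t σ ih =>
    simp only [Term.subst, Term.interp, ih h, Idx.interp_subst h.idx]
    cases t.interp θ <;> first | rfl | exact Sem.iapp_pre m _ _
  | un o t ih =>
    simp only [Term.subst, Term.interp, ih h]
    cases t.interp θ <;> first | rfl | exact Sem.un_pre m _ _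
  | bin o t u h₁ h₂ =>
    simp only [Term.subst, Term.interp, h₁ h, h₂ h]
    cases t.interp θ <;> cases u.interp θ <;> first | rfl | exact Sem.bin_pre m _ _ _
  | sum t u h₁ h₂ =>
    simp only [Term.subst, Term.interp, h₁ h, h₂ h]
    cases t.interp θ <;> cases u.interp θ <;> first | rfl | exact Sem.sum_pre m _ _
  | zeroO σ τ =>
    simp only [Term.subst, Term.interp]
    rw [Idx.interp_subst h.idx σ, Idx.interp_subst h.idx τ]
    rfl
  | zeroK σ | zeroB σ | oneO σ | univ σ =>
    simp only [Term.subst, Term.interp]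
    rw [Idx.interp_subst h.idx σ]
    rfl
  | b0 | b1 | sc0 | sc1 => rfl

/-! ### Soundness of typing -/

theorem IdxWF.wf {Γ : Ctx} {σ : Idx} (h : IdxWF Γ σ) : WF Γ := by
  induction σ with
  | prod σ τ h₁ h₂ => cases h with | prod h h' => exact h₁ h
  | _ => cases h; assumption

theorem TyWF.wf {Γ : Ctx} {T : Ty} (h : TyWF Γ T) : WF Γ := by
  induction T generalizing Γ with
  | all T ih => cases h with | all h => cases ih h; assumption
  | arrow T U h₁ h₂ => cases h with | arrow h h' => exact h₁ h
  | scalar => cases h; assumption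
  | _ => cases h; exact IdxWF.wf ‹_›

theorem HasType.wf {Γ : Ctx} {t : Term} {T : Ty} (h : HasType Γ t T) : WF Γ := by
  induction t generalizing Γ T with
  | lam U t ih => cases h with | lam h => cases ih h with | assumTerm h => exact h.wf
  | ilam t ih => cases h with | ilam h => cases ih h; assumption
  | app t u h₁ h₂ => cases h with | app h h' => exact h₁ h
  | iapp t σ ih => cases h with | iapp h h' => exact ih h
  | un o t ih => cases h <;> exact ih ‹_›
  | bin o t u h₁ h₂ => cases h <;> exact h₁ ‹_›
  | sum t u h₁ h₂ => cases h; exact h₁ ‹_›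
  | zeroK | zeroB | zeroO | oneO | univ => cases h; exact IdxWF.wf ‹_›
  | _ => cases h <;> assumption

/-- The tags are those of a valuation that respects the types declared in the context.  In contrast
to `ValidFor`, this can be satisfied even if some declared type has no elements. -/
def TagsFor : Ctx → List Tag → Prop
  | [], [] => True
  | .idx :: Γ, .idx _ :: θ => TagsFor Γ θ
  | .assum T :: Γ, .tm S :: θ => S = T.interp θ ∧ TagsFor Γ θ
  | .defn _ T :: Γ, .tm S :: θ => S = T.interp θ ∧ TagsFor Γ θ
  | _, _ => False

theorem Ty.interp_ren_add (g : Tag) (θ : List Tag) (T : Ty) (k : ℕ) :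
    (T.ren (· + (k + 1))).interp (g :: θ) = (T.ren (· + k)).interp θ := by
  have key (θ : List Tag) (k : ℕ) : (T.ren (· + k)).interp θ = T.interp (θ.drop k) :=
    T.interp_ren fun n => by simp [Idx.interp, Nat.add_comm]
  rw [key, key, List.drop_succ_cons]

/-- Every declared variable has a value, of the type declared for it. -/
theorem TagsFor.lookup {Γ : Ctx} {θ : List Tag} (h : TagsFor Γ θ) {n : ℕ} {T : Ty}
    (hn : Γ[n]? = some (.assum T) ∨ ∃ t, Γ[n]? = some (.defn t T)) :
    ∃ f, lookup θ n = some ⟨(T.ren (· + (n + 1))).interp θ, f⟩ := by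
  induction Γ generalizing θ n with
  | nil => simp at hn
  | cons e Γ ih =>
    obtain _ | ⟨g, θ⟩ := θ
    · cases e <;> exact h.elim
    rw [Ty.interp_ren_add]
    cases n with
    | zero =>
      have hT : (T.ren (· + 0)).interp θ = T.interp θ := T.interp_ren fun _ => rfl
      rw [hT]
      cases e with
      | idx => simp at hn
      | _ =>
        cases g with
        | idx => exact h.elim
        | tm S =>
          obtain ⟨rfl, -⟩ := h
          simp at hn
          subst hn
          exact ⟨_, rfl⟩
    | succ n =>
      have h' : TagsFor Γ θ := by
        cases e <;> cases g <;> first | exact h.elim | exact h.2 | exact h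
      obtain ⟨f, hf⟩ := ih h' (by simpa using hn)
      rw [lookup_succ, hf]
      exact ⟨_, rfl⟩

theorem Ty.interp_inst (U : Ty) (σ : Idx) (θ : List Tag) :
    (U.inst σ).interp θ = U.interp (.idx (σ.interp θ) :: θ) :=
  U.interp_subst fun n => by cases n <;> simp [instIdx, Idx.interp]

-- In the cases of `BinOp.sem` that compare index sets, equal index sets make the casts disappear.

theorem BinOp.sem_delta (A : FinSet) : BinOp.sem .delta (.basis A) (.basis A) =
    some ⟨.vec .scalar, fun (i j : A) => open Classical in if i = j then (1 : ℂ) else 0⟩ :=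
  dif_pos rfl

theorem BinOp.sem_add (V : VSort) :
    BinOp.sem .add (.vec V) (.vec V) = some ⟨.vec V, fun x y => x + y⟩ :=
  dif_pos rfl

theorem BinOp.sem_dotBK (A : FinSet) : BinOp.sem .dot (.vec (.bra A)) (.vec (.ket A)) =
    some ⟨.vec .scalar, fun (x : StrongDual ℂ (Hilb A)) (y : Hilb A) => x y⟩ :=
  dif_pos rfl

theorem BinOp.sem_dotOK (A B : FinSet) : BinOp.sem .dot (.vec (.opt A B)) (.vec (.ket B)) =
    some ⟨.vec (.ket A), fun (f : Hilb B →L[ℂ] Hilb A) (y : Hilb B) => f y⟩ :=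
  dif_pos rfl

theorem BinOp.sem_dotBO (A B : FinSet) : BinOp.sem .dot (.vec (.bra A)) (.vec (.opt A B)) =
    some ⟨.vec (.bra B), fun (x : StrongDual ℂ (Hilb A)) (f : Hilb B →L[ℂ] Hilb A) => x.comp f⟩ :=
  dif_pos rfl

theorem BinOp.sem_dotOO (A B C : FinSet) : BinOp.sem .dot (.vec (.opt A B)) (.vec (.opt B C)) =
    some ⟨.vec (.opt A C), fun (f : Hilb B →L[ℂ] Hilb A) (g : Hilb C →L[ℂ] Hilb B) => f.comp g⟩ :=
  dif_pos rfl

/-- A well-typed term has a denotation, and it belongs to the denotation of its type. -/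
theorem HasType.interp {Γ : Ctx} {t : Term} {T : Ty} (h : HasType Γ t T) {θ : List Tag}
    (hθ : TagsFor Γ θ) : ∃ f, t.interp θ = some ⟨T.interp θ, f⟩ := by
  induction t generalizing Γ T θ with
  | var n =>
    cases h with
    | var _ h => exact hθ.lookup (.inl h)
    | defVar _ h => exact hθ.lookup (.inr ⟨_, h⟩)
  | lam U t ih =>
    cases h with
    | lam h =>
      have h' := ih h (θ := .tm (U.interp θ) :: θ) ⟨rfl, hθ⟩
      rw [Ty.interp_lift] at h'
      obtain ⟨f, hf⟩ := h'
      exact ⟨_, by simp only [Term.interp, hf]; rfl⟩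
  | ilam t ih =>
    cases h with
    | @ilam _ U _ h =>
      choose F hF using fun X => ih h (θ := .idx X :: θ) hθ
      refine ⟨fun v X => F X v, ?_⟩
      change Sem.all (fun X => t.interp (.idx X :: θ)) = _
      rw [funext hF]
      simp [Sem.all, Ty.interp]
  | app t u h₁ h₂ =>
    cases h with
    | app h h' =>
      obtain ⟨f, hf⟩ := h₁ h hθ
      obtain ⟨g, hg⟩ := h₂ h' hθ
      exact ⟨_, by simp [Term.interp, hf, hg, Sem.app, Ty.interp]; rfl⟩
  | iapp t σ ih =>
    cases h with
    | iapp h h' =>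
      obtain ⟨f, hf⟩ := ih h hθ
      rw [Ty.interp_inst]
      exact ⟨_, by simp [Term.interp, hf, Sem.iapp, Ty.interp]; rfl⟩
  | un o t ih =>
    cases h <;>
    · obtain ⟨f, hf⟩ := ih ‹_› hθ
      exact ⟨_, by simp only [Term.interp, hf]; rfl⟩
  | bin o t u h₁ h₂ =>
    cases h with
    | smul hT h h' =>
      obtain ⟨f, hf⟩ := h₁ h hθ
      obtain ⟨g, hg⟩ := h₂ h' hθ
      cases hT <;>
        exact ⟨_, by simp only [Term.interp, hf, hg]; rfl⟩
    | add hT h h' =>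
      obtain ⟨f, hf⟩ := h₁ h hθ
      obtain ⟨g, hg⟩ := h₂ h' hθ
      cases hT <;>
        exact ⟨_, by simp only [Term.interp, hf, hg, Option.bind_some, Ty.interp, Sem.bin,
          BinOp.sem_add]; rfl⟩
    | _ =>
      obtain ⟨f, hf⟩ := h₁ ‹_› hθ
      obtain ⟨g, hg⟩ := h₂ ‹_› hθ
      exact ⟨_, by simp only [Term.interp, hf, hg, Option.bind_some, Ty.interp, Sem.bin,
        BinOp.sem_delta, BinOp.sem_dotBK, BinOp.sem_dotOK, BinOp.sem_dotBO, BinOp.sem_dotOO]; rfl⟩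
  | sum s u h₁ h₂ =>
    cases h with
    | sum hT h h' =>
      obtain ⟨f, hf⟩ := h₁ h hθ
      obtain ⟨g, hg⟩ := h₂ h' hθ
      cases hT <;>
        exact ⟨_, by simp only [Term.interp, hf, hg, Option.bind_some, Ty.interp, Sem.sum,
          dite_true]; rfl⟩
  | _ => cases h; exact ⟨_, rfl⟩

/-- For `x := t : T` the tag is the semantic type of `t`, which is that of `T` because `t : T` in a
well-formed context. -/
theorem ValidFor.tagsFor {Γ : Ctx} (hΓ : WF Γ) {θ : List Tag} {v : Env θ} (h : ValidFor Γ θ v) :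
    TagsFor Γ θ := by
  induction Γ generalizing θ with
  | nil => cases θ <;> trivial
  | cons e Γ ih =>
    obtain _ | ⟨g | S, θ⟩ := θ
    · cases e <;> exact h.elim
    · cases hΓ with
      | assumIdx hΓ => exact ih hΓ h
      | _ => exact h.elim
    · cases hΓ with
      | assumIdx hΓ => exact h.elim
      | assumTerm hΓ => exact ⟨h.1, ih hΓ.wf h.2⟩
      | defTerm ht =>
        have hθ := ih ht.wf h.2
        obtain ⟨f, hf⟩ := ht.interp hθ
        have h1 := h.1
        simp only [Term.eval, hf, Option.map_some, Option.some.injEq] at h1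
        exact ⟨(congrArg Sigma.fst h1).symm, hθ⟩

/-! ### Kets, bras and Kronecker products -/

section Spaces

variable {A B C D E F : FinSet}

@[simp] theorem ketOf_apply (i j : A) : (ketOf i).ofLp j = if j = i then 1 else 0 := by
  simp [ketOf]

theorem inner_ketOf (i : A) (x : Hilb A) : inner ℂ (ketOf i) x = x.ofLp i :=
  (EuclideanSpace.inner_single_left i 1 x).trans (by simp)

@[simp] theorem braOf_apply (i : A) (x : Hilb A) : braOf i x = x.ofLp i :=
  inner_ketOf i x

theorem sum_smul_ketOf (x : Hilb A) : ∑ i, x.ofLp i • ketOf i = x := by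
  ext j
  simp

/-- Linear maps out of `ℋ_A` that agree on the basis are equal. -/
theorem clm_ext {V : Type*} [AddCommGroup V] [Module ℂ V] [TopologicalSpace V]
    {f g : Hilb A →L[ℂ] V} (h : ∀ i, f (ketOf i) = g (ketOf i)) : f = g := by
  ext x
  rw [← sum_smul_ketOf x]
  simp only [map_sum, map_smul, h]

@[simp] theorem tensorKet_apply (x : Hilb A) (y : Hilb B) (p : A × B) :
    (tensorKet x y).ofLp p = x.ofLp p.1 * y.ofLp p.2 := rfl

theorem tensorKet_ketOf (i : A) (j : B) :
    tensorKet (ketOf i) (ketOf j) = ketOf (A := A.prod B) (i, j) := by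
  ext p
  simp only [tensorKet_apply, ketOf_apply]
  have : p = (i, j) ↔ p.1 = i ∧ p.2 = j := Prod.ext_iff
  by_cases h₁ : p.1 = i <;> by_cases h₂ : p.2 = j <;> simp [this, h₁, h₂]

/-- Linear maps out of `ℋ_{A × B}` that agree on the product kets are equal. -/
theorem clm_ext_tensor {V : Type*} [AddCommGroup V] [Module ℂ V] [TopologicalSpace V]
    {f g : Hilb (A.prod B) →L[ℂ] V}
    (h : ∀ (x : Hilb A) (y : Hilb B), f (tensorKet x y) = g (tensorKet x y)) : f = g :=
  clm_ext fun p => by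
    have := h (ketOf p.1) (ketOf p.2)
    rwa [tensorKet_ketOf] at this

@[simp] theorem tensorBra_tensorKet (f : StrongDual ℂ (Hilb A)) (g : StrongDual ℂ (Hilb B))
    (x : Hilb A) (y : Hilb B) : tensorBra f g (tensorKet x y) = f x * g y := by
  conv_rhs => rw [← sum_smul_ketOf x, ← sum_smul_ketOf y]
  simp only [map_sum, map_smul, Finset.sum_mul_sum, tensorBra, _root_.sum_apply,
    _root_.smul_apply, braOf_apply, tensorKet_apply, smul_eq_mul]
  rw [Fintype.sum_prod_type]
  refine Finset.sum_congr rfl fun i _ => Finset.sum_congr rfl fun j _ => ?_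
  ring

theorem toEuclideanLin_symm_apply (f : Hilb B →L[ℂ] Hilb A) (i : A) (j : B) :
    Matrix.toEuclideanLin.symm f.toLinearMap i j = (f (ketOf j)).ofLp i := by
  obtain ⟨M, hM⟩ := Matrix.toEuclideanLin.surjective f.toLinearMap
  have h : f (ketOf j) = Matrix.toEuclideanLin M (ketOf j) := (LinearMap.congr_fun hM _).symm
  rw [h, ← hM, LinearEquiv.symm_apply_apply]
  simp [Matrix.toLpLin_apply, ketOf]

@[simp] theorem tensorOpt_tensorKet (f : Hilb B →L[ℂ] Hilb A) (g : Hilb D →L[ℂ] Hilb C)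
    (x : Hilb B) (y : Hilb D) : tensorOpt f g (tensorKet x y) = tensorKet (f x) (g y) := by
  ext p
  conv_rhs => rw [← sum_smul_ketOf x, ← sum_smul_ketOf y]
  simp only [map_sum, map_smul, tensorOpt, tensorKet_apply, WithLp.ofLp_sum, WithLp.ofLp_smul,
    Finset.sum_apply, Pi.smul_apply, Finset.sum_mul_sum, LinearMap.coe_toContinuousLinearMap',
    Matrix.toLpLin_apply, Matrix.mulVec, dotProduct, smul_eq_mul]
  rw [Fintype.sum_prod_type]
  refine Finset.sum_congr rfl fun i _ => Finset.sum_congr rfl fun j _ => ?_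
  rw [Matrix.kronecker, Matrix.kroneckerMap_apply, toEuclideanLin_symm_apply,
    toEuclideanLin_symm_apply]
  ring

theorem tensorKet_bilin : ∃ β : Hilb A →ₗ[ℂ] Hilb B →ₗ[ℂ] Hilb (A.prod B),
    ∀ x y, tensorKet x y = β x y := by
  refine ⟨LinearMap.mk₂ ℂ tensorKet ?_ ?_ ?_ ?_, fun _ _ => rfl⟩ <;>
  · intros
    ext p
    simp only [tensorKet_apply, PiLp.add_apply, PiLp.smul_apply, smul_eq_mul]
    ring

theorem tensorBra_bilin :
    ∃ β : StrongDual ℂ (Hilb A) →ₗ[ℂ] StrongDual ℂ (Hilb B) →ₗ[ℂ] StrongDual ℂ (Hilb (A.prod B)),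
    ∀ x y, tensorBra x y = β x y := by
  refine ⟨LinearMap.mk₂ ℂ tensorBra ?_ ?_ ?_ ?_, fun _ _ => rfl⟩ <;>
  · intros
    refine clm_ext_tensor fun x y => ?_
    simp only [tensorBra_tensorKet, _root_.add_apply, _root_.smul_apply,
      smul_eq_mul]
    ring

theorem tensorOpt_bilin : ∃ β : (Hilb B →L[ℂ] Hilb A) →ₗ[ℂ] (Hilb D →L[ℂ] Hilb C) →ₗ[ℂ]
      (Hilb (B.prod D) →L[ℂ] Hilb (A.prod C)),
    ∀ x y, tensorOpt x y = β x y := by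
  refine ⟨LinearMap.mk₂ ℂ tensorOpt ?_ ?_ ?_ ?_, fun _ _ => rfl⟩ <;>
  · intros
    refine clm_ext_tensor fun x y => ?_
    ext p
    simp only [tensorOpt_tensorKet, _root_.add_apply, _root_.smul_apply,
      PiLp.add_apply, PiLp.smul_apply, tensorKet_apply, smul_eq_mul]
    ring

theorem tensorBra_comp_tensorOpt (x : StrongDual ℂ (Hilb A)) (y : StrongDual ℂ (Hilb C))
    (f : Hilb B →L[ℂ] Hilb A) (g : Hilb D →L[ℂ] Hilb C) :
    (tensorBra x y).comp (tensorOpt f g) = tensorBra (x.comp f) (y.comp g) :=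
  clm_ext_tensor fun _ _ => by simp

theorem tensorOpt_comp_tensorOpt (f : Hilb B →L[ℂ] Hilb A) (g : Hilb D →L[ℂ] Hilb C)
    (f' : Hilb E →L[ℂ] Hilb B) (g' : Hilb F →L[ℂ] Hilb D) :
    (tensorOpt f g).comp (tensorOpt f' g') = tensorOpt (f.comp f') (g.comp g') :=
  clm_ext_tensor fun _ _ => by simp

theorem smulRight_tensor (x : Hilb A) (y : Hilb C) (f : StrongDual ℂ (Hilb B))
    (g : StrongDual ℂ (Hilb D)) :
    (tensorBra f g).smulRight (tensorKet x y) = tensorOpt (f.smulRight x) (g.smulRight y) :=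
  clm_ext_tensor fun _ _ => by
    ext p
    simp only [ContinuousLinearMap.smulRight_apply, tensorBra_tensorKet, tensorOpt_tensorKet,
      tensorKet_apply, PiLp.smul_apply, smul_eq_mul]
    ring

theorem tensorOpt_id : tensorOpt (.id ℂ (Hilb A)) (.id ℂ (Hilb B)) = .id ℂ (Hilb (A.prod B)) :=
  clm_ext_tensor fun _ _ => by simp

theorem inner_tensorKet (x x' : Hilb A) (y y' : Hilb B) :
    inner ℂ (tensorKet x y) (tensorKet x' y') = inner ℂ x x' * inner ℂ y y' := by
  simp only [PiLp.inner_apply, Finset.sum_mul_sum, tensorKet_apply]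
  rw [Fintype.sum_prod_type]
  refine Finset.sum_congr rfl fun i _ => Finset.sum_congr rfl fun j _ => ?_
  simp
  ring

theorem toDual_tensorKet (x : Hilb A) (y : Hilb B) :
    InnerProductSpace.toDual ℂ (Hilb (A.prod B)) (tensorKet x y) =
      tensorBra (InnerProductSpace.toDual ℂ (Hilb A) x) (InnerProductSpace.toDual ℂ (Hilb B) y) :=
  clm_ext_tensor fun _ _ => by simp [inner_tensorKet]

theorem toDual_symm_tensorBra (x : StrongDual ℂ (Hilb A)) (y : StrongDual ℂ (Hilb B)) :
    (InnerProductSpace.toDual ℂ (Hilb (A.prod B))).symm (tensorBra x y) =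
      tensorKet ((InnerProductSpace.toDual ℂ (Hilb A)).symm x)
        ((InnerProductSpace.toDual ℂ (Hilb B)).symm y) := by
  rw [LinearIsometryEquiv.symm_apply_eq, toDual_tensorKet]
  simp

theorem adjoint_tensorOpt (f : Hilb B →L[ℂ] Hilb A) (g : Hilb D →L[ℂ] Hilb C) :
    ContinuousLinearMap.adjoint (tensorOpt f g) =
      tensorOpt (ContinuousLinearMap.adjoint f) (ContinuousLinearMap.adjoint g) :=
  clm_ext_tensor fun x y => by
    ext p
    rw [← inner_ketOf (A := B.prod D) p, ← inner_ketOf (A := B.prod D) p]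
    obtain ⟨i, j⟩ := p
    rw [← tensorKet_ketOf, ContinuousLinearMap.adjoint_inner_right]
    simp only [tensorOpt_tensorKet, inner_tensorKet, ContinuousLinearMap.adjoint_inner_right]

theorem toDual_apply_clm (f : Hilb B →L[ℂ] Hilb A) (x : Hilb B) :
    InnerProductSpace.toDual ℂ (Hilb A) (f x) =
      (InnerProductSpace.toDual ℂ (Hilb B) x).comp (ContinuousLinearMap.adjoint f) := by
  ext y
  simp [ContinuousLinearMap.adjoint_inner_right]

theorem toDual_symm_comp (x : StrongDual ℂ (Hilb A)) (f : Hilb B →L[ℂ] Hilb A) :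
    (InnerProductSpace.toDual ℂ (Hilb B)).symm (x.comp f) =
      ContinuousLinearMap.adjoint f ((InnerProductSpace.toDual ℂ (Hilb A)).symm x) := by
  rw [LinearIsometryEquiv.symm_apply_eq, toDual_apply_clm]
  simp

theorem adjoint_smulRight (x : Hilb A) (y : StrongDual ℂ (Hilb B)) :
    ContinuousLinearMap.adjoint (y.smulRight x) =
      (InnerProductSpace.toDual ℂ (Hilb A) x).smulRight
        ((InnerProductSpace.toDual ℂ (Hilb B)).symm y) := by
  symm
  rw [ContinuousLinearMap.eq_adjoint_iff]
  intro a b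
  simp [inner_smul_left, inner_smul_right, mul_comm]

theorem sum_outer_ketOf :
    ∑ i : A, (braOf i).smulRight (ketOf i) = ContinuousLinearMap.id ℂ (Hilb A) := by
  ext1 x
  simp [sum_smul_ketOf]

theorem star_apply_ket (x : StrongDual ℂ (Hilb A)) (y : Hilb A) :
    starRingEnd ℂ (x y) =
      InnerProductSpace.toDual ℂ (Hilb A) y ((InnerProductSpace.toDual ℂ (Hilb A)).symm x) := by
  rw [InnerProductSpace.toDual_apply_apply, ← inner_conj_symm,
    InnerProductSpace.toDual_symm_apply]

end Spaces

/-! ### Values of terms -/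

/-- Values: elements of semantic types. -/
abbrev Val : Type 1 := (S : SemTy) × S.El

/-- A basis element as a value. -/
abbrev Val.basis {A : FinSet} (i : A) : Val := ⟨.ground (.basis A), ⟨i⟩⟩

/-- A subset of the basis as a value. -/
abbrev Val.set {A : FinSet} (s : Set A) : Val := ⟨.ground (.set A), ⟨s⟩⟩

/-- A scalar, ket, bra or operator as a value. -/
abbrev Val.vec (V : VSort) (x : V.El) : Val := ⟨.ground (.vec V), ⟨x⟩⟩

theorem Val.sort_inj {V W : VSort} {x : V.El} {y : W.El} (h : Val.vec V x = Val.vec W y) :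
    V = W := by
  simpa using congrArg Sigma.fst h

theorem Val.vec_inj {V : VSort} {x y : V.El} (h : Val.vec V x = Val.vec V y) : x = y := by
  injection h with _ h
  exact congrArg ULift.down h

/-- The value of a unary operation. -/
noncomputable def Val.un (o : UnOp) : Val → Option Val
  | ⟨.ground g, x⟩ => (o.sem g).map fun r => ⟨.ground r.1, ⟨r.2 x.down⟩⟩
  | _ => none

/-- The value of a binary operation. -/
noncomputable def Val.bin (o : BinOp) : Val → Val → Option Val
  | ⟨.ground g, x⟩, ⟨.ground h, y⟩ =>
      (o.sem g h).map fun r => ⟨.ground r.1, ⟨r.2 x.down y.down⟩⟩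
  | _, _ => none

/-- The value of an application to a term. -/
noncomputable def Val.app : Val → Val → Option Val
  | ⟨.arrow A B, f⟩, ⟨A', a⟩ =>
      open Classical in
      if h : A' = A then some ⟨B, f (h ▸ a)⟩ else none
  | _, _ => none

/-- The value of an application to an index. -/
def Val.iapp : Val → FinSet → Option Val
  | ⟨.all F, f⟩, X => some ⟨F X, f X⟩
  | _, _ => none

/-- The value of `∑_s f`, for a set `s` and a function `f` with values in a space of vectors. -/
noncomputable def Val.sum : Val → Val → Option Val
  | ⟨.ground (.set A), s⟩, ⟨.arrow (.ground (.basis A')) (.ground (.vec V)), f⟩ =>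
      open Classical in
      if h : A = A' then
        some (.vec V (∑ m ∈ Finset.univ.filter (fun m : A => m ∈ s.down),
            ((f ⟨(h ▸ m : A')⟩).down : V.El)))
      else none
  | _, _ => none

section Eval

variable {θ : List Tag} {v : Env θ}

theorem Term.eval_un (o : UnOp) (t : Term) :
    (Term.un o t).eval θ v = (t.eval θ v).bind (Val.un o) := by
  simp only [Term.eval, Term.interp]
  rcases t.interp θ with _ | ⟨S, f⟩
  · rfl
  · cases S with
    | ground g =>
      simp only [Option.bind_some, Option.map_some, Sem.un, Val.un]
      cases o.sem g <;> rfl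
    | _ => rfl

theorem Term.eval_bin (o : BinOp) (t u : Term) :
    (Term.bin o t u).eval θ v =
      (t.eval θ v).bind fun x => (u.eval θ v).bind fun y => Val.bin o x y := by
  simp only [Term.eval, Term.interp]
  rcases t.interp θ with _ | ⟨S, f⟩
  · rfl
  rcases u.interp θ with _ | ⟨S', f'⟩
  · rfl
  cases S <;> cases S' <;> try rfl
  rename_i g h
  simp only [Option.bind_some, Option.map_some, Sem.bin, Val.bin]
  cases o.sem g h <;> rfl

theorem Term.eval_app (t u : Term) :
    (Term.app t u).eval θ v =
      (t.eval θ v).bind fun x => (u.eval θ v).bind fun y => Val.app x y := by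
  simp only [Term.eval, Term.interp]
  rcases t.interp θ with _ | ⟨S, f⟩
  · rfl
  rcases u.interp θ with _ | ⟨S', f'⟩
  · rfl
  cases S with
  | arrow A B =>
    simp only [Option.bind_some, Option.map_some, Sem.app, Val.app]
    by_cases h : S' = A
    · subst h
      rw [dif_pos rfl, dif_pos rfl]
      rfl
    · rw [dif_neg h, dif_neg h]
      rfl
  | _ => rfl

theorem Term.eval_iapp (t : Term) (σ : Idx) :
    (Term.iapp t σ).eval θ v = (t.eval θ v).bind fun x => Val.iapp x (σ.interp θ) := by
  simp only [Term.eval, Term.interp]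
  rcases t.interp θ with _ | ⟨S, f⟩
  · rfl
  cases S <;> rfl

theorem Term.eval_sum (t u : Term) :
    (Term.sum t u).eval θ v =
      (t.eval θ v).bind fun x => (u.eval θ v).bind fun y => Val.sum x y := by
  simp only [Term.eval, Term.interp]
  rcases t.interp θ with _ | ⟨S, s⟩
  · rfl
  rcases u.interp θ with _ | ⟨T, f⟩
  · rfl
  simp only [Option.bind_some, Option.map_some]
  unfold Sem.sum
  split
  · rename_i A s A' V f heq heq'
    cases heq
    cases heq'
    by_cases h : A = A' <;> simp [h, Val.sum]
  · rename_i hn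
    unfold Val.sum
    split
    · rename_i A s A' V f heq heq'
      cases heq
      cases heq'
      exact (hn _ _ _ _ _ rfl rfl).elim
    · rfl

theorem Term.eval_ren {f : ℕ → ℕ} {θ' : List Tag} {m : Env θ' → Env θ} (h : RenOk f m)
    (t : Term) (v : Env θ') : (t.ren f).eval θ' v = t.eval θ (m v) := by
  simp only [Term.eval, Term.interp_ren h]
  cases t.interp θ <;> rfl

theorem Term.eval_subst {ρ : ℕ → Idx} {s : ℕ → Term} {θ' : List Tag} {m : Env θ' → Env θ}
    (h : SubstOk ρ s m) (t : Term) (v : Env θ') :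
    (t.subst ρ s).eval θ' v = t.eval θ (m v) := by
  simp only [Term.eval, Term.interp_subst h]
  cases t.interp θ <;> rfl

/-- The valuation with one more term variable, with a value in a finite set. -/
def Env.push {X : FinSet} (m : X) (v : Env θ) : Env (.tm (.ground (.basis X)) :: θ) := (⟨m⟩, v)

theorem Term.eval_lift_push {X : FinSet} (m : X) (t : Term) :
    t.lift.eval (.tm (.ground (.basis X)) :: θ) (Env.push m v) = t.eval θ v :=
  Term.eval_ren (.succ (.tm (.ground (.basis X))) θ) t _

end Eval

/-! ### The operations as relations between values -/

/-- `UnRel o a r` says that the operation `o` has the value `r` at `a`.  This is the graph of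
`Val.un`, in a form that allows case analysis. -/
inductive UnRel : UnOp → Val → Val → Prop
  | conj (a : ℂ) : UnRel .conj (.vec .scalar a) (.vec .scalar (starRingEnd ℂ a))
  | ket {A : FinSet} (i : A) : UnRel .ket (.basis i) (.vec (.ket A) (ketOf i))
  | bra {A : FinSet} (i : A) : UnRel .bra (.basis i) (.vec (.bra A) (braOf i))
  | dagK {A : FinSet} (x : Hilb A) :
      UnRel .dag (.vec (.ket A) x) (.vec (.bra A) (InnerProductSpace.toDual ℂ (Hilb A) x))
  | dagB {A : FinSet} (x : StrongDual ℂ (Hilb A)) :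
      UnRel .dag (.vec (.bra A) x) (.vec (.ket A) ((InnerProductSpace.toDual ℂ (Hilb A)).symm x))
  | dagO {A B : FinSet} (f : Hilb B →L[ℂ] Hilb A) :
      UnRel .dag (.vec (.opt A B) f) (.vec (.opt B A) (ContinuousLinearMap.adjoint f))

open Classical in
/-- `BinRel o a b r` says that the operation `o` has the value `r` at `a` and `b`.  This is the
graph of `Val.bin`, in a form that allows case analysis and is free of casts between index sets. -/
inductive BinRel : BinOp → Val → Val → Val → Prop
  | pair {A B : FinSet} (i : A) (j : B) :
      BinRel .pair (.basis i) (.basis j) (.basis (A := A.prod B) (i, j))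
  | delta {A : FinSet} (i j : A) :
      BinRel .delta (.basis i) (.basis j) (.vec .scalar (if i = j then (1 : ℂ) else 0))
  | mul (a b : ℂ) : BinRel .mul (.vec .scalar a) (.vec .scalar b) (.vec .scalar (a * b : ℂ))
  | smul {V : VSort} (a : ℂ) (x : V.El) :
      BinRel .smul (.vec .scalar a) (.vec V x) (.vec V (a • x))
  | add {V : VSort} (x y : V.El) : BinRel .add (.vec V x) (.vec V y) (.vec V (x + y))
  | tensorK {A B : FinSet} (x : Hilb A) (y : Hilb B) :
      BinRel .tensor (.vec (.ket A) x) (.vec (.ket B) y) (.vec (.ket (A.prod B)) (tensorKet x y))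
  | tensorB {A B : FinSet} (x : StrongDual ℂ (Hilb A)) (y : StrongDual ℂ (Hilb B)) :
      BinRel .tensor (.vec (.bra A) x) (.vec (.bra B) y) (.vec (.bra (A.prod B)) (tensorBra x y))
  | tensorO {A B C D : FinSet} (f : Hilb B →L[ℂ] Hilb A) (g : Hilb D →L[ℂ] Hilb C) :
      BinRel .tensor (.vec (.opt A B) f) (.vec (.opt C D) g)
        (.vec (.opt (A.prod C) (B.prod D)) (tensorOpt f g))
  | dotBK {A : FinSet} (x : StrongDual ℂ (Hilb A)) (y : Hilb A) :
      BinRel .dot (.vec (.bra A) x) (.vec (.ket A) y) (.vec .scalar (x y))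
  | dotOK {A B : FinSet} (f : Hilb B →L[ℂ] Hilb A) (y : Hilb B) :
      BinRel .dot (.vec (.opt A B) f) (.vec (.ket B) y) (.vec (.ket A) (f y))
  | dotBO {A B : FinSet} (x : StrongDual ℂ (Hilb A)) (f : Hilb B →L[ℂ] Hilb A) :
      BinRel .dot (.vec (.bra A) x) (.vec (.opt A B) f) (.vec (.bra B) (x.comp f))
  | dotKB {A B : FinSet} (x : Hilb A) (y : StrongDual ℂ (Hilb B)) :
      BinRel .dot (.vec (.ket A) x) (.vec (.bra B) y) (.vec (.opt A B) (y.smulRight x))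
  | dotOO {A B C : FinSet} (f : Hilb B →L[ℂ] Hilb A) (g : Hilb C →L[ℂ] Hilb B) :
      BinRel .dot (.vec (.opt A B) f) (.vec (.opt B C) g) (.vec (.opt A C) (f.comp g))
  | star {A B : FinSet} (s : Set A) (t : Set B) :
      BinRel .star (.set s) (.set t) (.set (A := A.prod B) (s ×ˢ t))

theorem UnRel.val {o : UnOp} {a r : Val} (h : UnRel o a r) : Val.un o a = some r := by
  cases h <;> rfl

theorem UnRel.det {o : UnOp} {a r r' : Val} (h : UnRel o a r) (h' : UnRel o a r') : r = r' :=
  Option.some.inj (h.val.symm.trans h'.val)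

theorem BinRel.val {o : BinOp} {a b r : Val} (h : BinRel o a b r) : Val.bin o a b = some r := by
  cases h with
  | delta => simp only [Val.bin, BinOp.sem_delta]; rfl
  | add => simp only [Val.bin, BinOp.sem_add]; rfl
  | dotBK => simp only [Val.bin, BinOp.sem_dotBK]; rfl
  | dotOK => simp only [Val.bin, BinOp.sem_dotOK]; rfl
  | dotBO => simp only [Val.bin, BinOp.sem_dotBO]; rfl
  | dotOO => simp only [Val.bin, BinOp.sem_dotOO]; rfl
  | _ => rfl

theorem BinRel.det {o : BinOp} {a b r r' : Val} (h : BinRel o a b r) (h' : BinRel o a b r') :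
    r = r' :=
  Option.some.inj (h.val.symm.trans h'.val)

theorem UnRel.of_val {o : UnOp} {a r : Val} (h : Val.un o a = some r) : UnRel o a r := by
  unfold Val.un at h
  split at h
  · rename_i g x
    cases hr : o.sem g with
    | none => simp [hr] at h
    | some k =>
      simp only [hr, Option.map_some, Option.some.injEq] at h
      subst h
      unfold UnOp.sem at hr
      split at hr <;> cases hr <;> constructor
  · cases h

theorem BinRel.of_val {o : BinOp} {a b r : Val} (h : Val.bin o a b = some r) :
    BinRel o a b r := by
  unfold Val.bin at h
  split at h
  · rename_i g x g' y
    cases hr : o.sem g g' with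
    | none => simp [hr] at h
    | some k =>
      simp only [hr, Option.map_some, Option.some.injEq] at h
      subst h
      unfold BinOp.sem at hr
      split at hr
      case h_2 =>
        split_ifs at hr with hA
        subst hA
        cases hr
        exact .delta x.down y.down
      case h_5 =>
        split_ifs at hr with hA
        subst hA
        cases hr
        exact .add x.down y.down
      case h_9 | h_10 | h_11 | h_13 =>
        split_ifs at hr with hA
        cases hA
        cases hr
        constructor
      all_goals cases hr <;> constructor
  · cases h

theorem Term.eval_un_iff {θ : List Tag} {v : Env θ} {o : UnOp} {t : Term} {r : Val} :
    (Term.un o t).eval θ v = some r ↔ ∃ a, t.eval θ v = some a ∧ UnRel o a r := by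
  rw [Term.eval_un, Option.bind_eq_some_iff]
  exact exists_congr fun a => and_congr_right fun _ => ⟨.of_val, fun h => h.val⟩

theorem Term.eval_bin_iff {θ : List Tag} {v : Env θ} {o : BinOp} {t u : Term} {r : Val} :
    (Term.bin o t u).eval θ v = some r ↔
      ∃ a, t.eval θ v = some a ∧ ∃ b, u.eval θ v = some b ∧ BinRel o a b r := by
  rw [Term.eval_bin, Option.bind_eq_some_iff]
  refine exists_congr fun a => and_congr_right fun _ => ?_
  rw [Option.bind_eq_some_iff]
  exact exists_congr fun b => and_congr_right fun _ => ⟨.of_val, fun h => h.val⟩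

/-! ### Linearity of the operations -/

/-- The binary operations that are bilinear. -/
inductive BinOp.IsBilin : BinOp → Prop
  | mul : IsBilin .mul
  | smul : IsBilin .smul
  | tensor : IsBilin .tensor
  | dot : IsBilin .dot

/-- Each case of a bilinear operation is given by a bilinear map, which makes all laws on sums,
multiples and zeros instances of general facts. -/
theorem BinRel.bilin {o : BinOp} (ho : o.IsBilin) {a b r : Val} (h : BinRel o a b r) :
    ∃ (V W U : VSort) (β : V.El →ₗ[ℂ] W.El →ₗ[ℂ] U.El) (x : V.El) (y : W.El),
      a = .vec V x ∧ b = .vec W y ∧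
      ∀ x' y', BinRel o (.vec V x') (.vec W y') (.vec U (β x' y')) := by
  cases h with
  | pair | delta | add | star => cases ho
  | mul a b => exact ⟨.scalar, .scalar, .scalar, LinearMap.mul ℂ ℂ, a, b, rfl, rfl, .mul⟩
  | @smul V a x => exact ⟨.scalar, V, V, LinearMap.lsmul ℂ V.El, a, x, rfl, rfl, .smul⟩
  | @tensorK A B x y =>
    obtain ⟨β, hβ⟩ := tensorKet_bilin (A := A) (B := B)
    exact ⟨.ket A, .ket B, .ket (A.prod B), β, x, y, rfl, rfl,
      fun x' y' => hβ x' y' ▸ .tensorK x' y'⟩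
  | @tensorB A B x y =>
    obtain ⟨β, hβ⟩ := tensorBra_bilin (A := A) (B := B)
    exact ⟨.bra A, .bra B, .bra (A.prod B), β, x, y, rfl, rfl,
      fun x' y' => hβ x' y' ▸ .tensorB x' y'⟩
  | @tensorO A B C D x y =>
    obtain ⟨β, hβ⟩ := tensorOpt_bilin (A := A) (B := B) (C := C) (D := D)
    exact ⟨.opt A B, .opt C D, .opt (A.prod C) (B.prod D), β, x, y, rfl, rfl,
      fun x' y' => hβ x' y' ▸ .tensorO x' y'⟩
  | @dotBK A x y =>
    exact ⟨.bra A, .ket A, .scalar,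
      LinearMap.mk₂ ℂ (fun (x : StrongDual ℂ (Hilb A)) (y : Hilb A) => x y)
        (fun _ _ _ => rfl) (fun _ _ _ => rfl) (fun x => map_add x) (fun c x => map_smul x c),
      x, y, rfl, rfl, .dotBK⟩
  | @dotOK A B x y =>
    exact ⟨.opt A B, .ket B, .ket A,
      LinearMap.mk₂ ℂ (fun (x : Hilb B →L[ℂ] Hilb A) (y : Hilb B) => x y)
        (fun _ _ _ => rfl) (fun _ _ _ => rfl) (fun x => map_add x) (fun c x => map_smul x c),
      x, y, rfl, rfl, .dotOK⟩
  | @dotBO A B x y =>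
    exact ⟨.bra A, .opt A B, .bra B,
      LinearMap.mk₂ ℂ (fun (x : StrongDual ℂ (Hilb A)) (y : Hilb B →L[ℂ] Hilb A) => x.comp y)
        (fun _ _ _ => rfl) (fun _ _ _ => rfl) (fun x => x.comp_add) (fun c x => x.comp_smul c),
      x, y, rfl, rfl, .dotBO⟩
  | @dotKB A B x y =>
    exact ⟨.ket A, .bra B, .opt A B,
      LinearMap.mk₂ ℂ (fun (x : Hilb A) (y : StrongDual ℂ (Hilb B)) => y.smulRight x)
        (fun x x' y => ContinuousLinearMap.ext fun z => smul_add (y z) x x')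
        (fun c x y => ContinuousLinearMap.ext fun z => smul_comm (y z) c x)
        (fun x y y' => ContinuousLinearMap.ext fun z => add_smul (y z) (y' z) x)
        (fun c x y => ContinuousLinearMap.ext fun z => mul_smul c (y z) x),
      x, y, rfl, rfl, .dotKB⟩
  | @dotOO A B C x y =>
    exact ⟨.opt A B, .opt B C, .opt A C,
      LinearMap.mk₂ ℂ (fun (x : Hilb B →L[ℂ] Hilb A) (y : Hilb C →L[ℂ] Hilb B) => x.comp y)
        (fun _ _ _ => rfl) (fun _ _ _ => rfl) (fun x => x.comp_add) (fun c x => x.comp_smul c),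
      x, y, rfl, rfl, .dotOO⟩

/-- The unary operations that are conjugate-linear. -/
inductive UnOp.IsConjLin : UnOp → Prop
  | conj : IsConjLin .conj
  | dag : IsConjLin .dag

theorem UnRel.conjLin {o : UnOp} (ho : o.IsConjLin) {a r : Val} (h : UnRel o a r) :
    ∃ (V U : VSort) (β : V.El →ₗ⋆[ℂ] U.El) (x : V.El),
      a = .vec V x ∧ ∀ x', UnRel o (.vec V x') (.vec U (β x')) := by
  cases h with
  | ket | bra => cases ho
  | conj a =>
    exact ⟨.scalar, .scalar, (starLinearEquiv ℂ (A := ℂ)).toLinearMap, a, rfl, .conj⟩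
  | @dagK A x =>
    exact ⟨.ket A, .bra A, (InnerProductSpace.toDual ℂ (Hilb A)).toLinearEquiv.toLinearMap,
      x, rfl, .dagK⟩
  | @dagB A x =>
    exact ⟨.bra A, .ket A, (InnerProductSpace.toDual ℂ (Hilb A)).symm.toLinearEquiv.toLinearMap,
      x, rfl, .dagB⟩
  | @dagO A B f =>
    exact ⟨.opt A B, .opt B A,
      (ContinuousLinearMap.adjoint (E := Hilb B) (F := Hilb A)).toLinearEquiv.toLinearMap,
      f, rfl, .dagO⟩

/-- A multiple of a vector, where scalars also count as vectors. -/
theorem BinRel.smul_of_mul {a b r : Val} (h : BinRel .mul a b r) : BinRel .smul a b r := by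
  cases h with
  | mul a b => exact .smul (V := .scalar) a b

section Laws

variable {o : BinOp} {a a₁ a₂ b b₁ b₂ c r r₁ r₂ r' : Val}

theorem BinRel.add_right (ho : o.IsBilin) (hb : BinRel .add b₁ b₂ b) (h : BinRel o a b r)
    (h₁ : BinRel o a b₁ r₁) (h₂ : BinRel o a b₂ r₂) (h' : BinRel .add r₁ r₂ r') : r = r' := by
  obtain ⟨V, W, U, β, x, y, rfl, rfl, hβ⟩ := h.bilin ho
  cases hb with
  | add y₁ y₂ =>
    cases h.det (hβ _ _)
    cases h₁.det (hβ _ _)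
    cases h₂.det (hβ _ _)
    cases h'
    rw [map_add]

theorem BinRel.add_left (ho : o.IsBilin) (ha : BinRel .add a₁ a₂ a) (h : BinRel o a b r)
    (h₁ : BinRel o a₁ b r₁) (h₂ : BinRel o a₂ b r₂) (h' : BinRel .add r₁ r₂ r') : r = r' := by
  obtain ⟨V, W, U, β, x, y, rfl, rfl, hβ⟩ := h.bilin ho
  cases ha with
  | add y₁ y₂ =>
    cases h.det (hβ _ _)
    cases h₁.det (hβ _ _)
    cases h₂.det (hβ _ _)
    cases h'
    rw [map_add, LinearMap.add_apply]

theorem BinRel.smul_right (ho : o.IsBilin) (hb : BinRel .smul c b₁ b) (h : BinRel o a b r)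
    (h₁ : BinRel o a b₁ r₁) (h' : BinRel .smul c r₁ r') : r = r' := by
  obtain ⟨V, W, U, β, x, y, rfl, rfl, hβ⟩ := h.bilin ho
  cases hb with
  | smul c y =>
    cases h.det (hβ _ _)
    cases h₁.det (hβ _ _)
    cases h'
    rw [map_smul]

theorem BinRel.smul_left (ho : o.IsBilin) (ha : BinRel .smul c a₁ a) (h : BinRel o a b r)
    (h₁ : BinRel o a₁ b r₁) (h' : BinRel .smul c r₁ r') : r = r' := by
  obtain ⟨V, W, U, β, x, y, rfl, rfl, hβ⟩ := h.bilin ho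
  cases ha with
  | smul c y =>
    cases h.det (hβ _ _)
    cases h₁.det (hβ _ _)
    cases h'
    rw [map_smul, LinearMap.smul_apply]

theorem BinRel.zero_right (ho : o.IsBilin) {W U : VSort} (h : BinRel o a (.vec W 0) r)
    (hT : r.1 = .ground (.vec U)) : r = .vec U 0 := by
  obtain ⟨V, W, U, β, x, y, rfl, hW, hβ⟩ := h.bilin ho
  cases hW
  cases h.det (hβ _ _)
  cases hT
  rw [map_zero]

theorem BinRel.zero_left (ho : o.IsBilin) {W U : VSort} (h : BinRel o (.vec W 0) b r)
    (hT : r.1 = .ground (.vec U)) : r = .vec U 0 := by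
  obtain ⟨V, W, U, β, x, y, hW, rfl, hβ⟩ := h.bilin ho
  cases hW
  cases h.det (hβ _ _)
  cases hT
  rw [map_zero, LinearMap.zero_apply]

end Laws

section ConjLaws

variable {o : UnOp} {a a₁ a₂ c c' r r₁ r₂ r' : Val}

theorem UnRel.add (ho : o.IsConjLin) (ha : BinRel .add a₁ a₂ a) (h : UnRel o a r)
    (h₁ : UnRel o a₁ r₁) (h₂ : UnRel o a₂ r₂) (h' : BinRel .add r₁ r₂ r') : r = r' := by
  obtain ⟨V, U, β, x, rfl, hβ⟩ := h.conjLin ho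
  cases ha with
  | add y₁ y₂ =>
    cases h.det (hβ _)
    cases h₁.det (hβ _)
    cases h₂.det (hβ _)
    cases h'
    rw [map_add]

theorem UnRel.smul (ho : o.IsConjLin) (ha : BinRel .smul c a₁ a) (h : UnRel o a r)
    (hc : UnRel .conj c c') (h₁ : UnRel o a₁ r₁) (h' : BinRel .smul c' r₁ r') : r = r' := by
  obtain ⟨V, U, β, x, rfl, hβ⟩ := h.conjLin ho
  cases ha with
  | smul c y =>
    cases h.det (hβ _)
    cases h₁.det (hβ _)
    cases hc
    cases h'
    rw [map_smulₛₗ]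

theorem UnRel.zero (ho : o.IsConjLin) {V U : VSort} (h : UnRel o (.vec V 0) r)
    (hT : r.1 = .ground (.vec U)) : r = .vec U 0 := by
  obtain ⟨V, U, β, x, hV, hβ⟩ := h.conjLin ho
  cases hV
  cases h.det (hβ _)
  cases hT
  rw [map_zero]

end ConjLaws

/-! ### Sums -/

open Classical in
/-- `SumRel s F r` says that `r` is the sum of the vectors `F m` over all `m` in the set `s`. -/
def SumRel {A : FinSet} (s : Set A) (F : A → Val) (r : Val) : Prop :=
  ∃ (V : VSort) (f : A → V.El), (∀ m, F m = .vec V (f m)) ∧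
    r = .vec V (∑ m ∈ Finset.univ.filter (· ∈ s), f m)

section Sums

variable {A : FinSet} {s : Set A} {F G H : A → Val} {o : BinOp} {a b r r₁ r₂ r' : Val}

/-- The equality of types is only needed if `A` is empty, as the family then does not determine in
which space its sum lies. -/
theorem SumRel.det {r r' : Val} (h : SumRel s F r) (h' : SumRel s F r') (hT : r.1 = r'.1) :
    r = r' := by
  obtain ⟨V, f, hf, rfl⟩ := h
  obtain ⟨W, g, hg, rfl⟩ := h'
  cases hT
  have : f = g := funext fun m =>
    Val.vec_inj ((hf m).symm.trans (hg m))
  rw [this]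

theorem BinRel.sum_right (ho : o.IsBilin) (hb : SumRel s G b) (h : BinRel o a b r)
    (hF : ∀ m, BinRel o a (G m) (F m)) (h' : SumRel s F r') (hT : r.1 = r'.1) : r = r' := by
  obtain ⟨V, W, U, β, x, y, rfl, rfl, hβ⟩ := h.bilin ho
  cases h.det (hβ _ _)
  obtain ⟨W, g, hg, hb⟩ := hb
  cases hb
  refine SumRel.det ⟨U, fun m => β x (g m), fun m => ?_, by rw [map_sum]⟩ h' hT
  have := hF m
  rw [hg] at this
  exact this.det (hβ _ _)

theorem BinRel.sum_left (ho : o.IsBilin) (ha : SumRel s G a) (h : BinRel o a b r)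
    (hF : ∀ m, BinRel o (G m) b (F m)) (h' : SumRel s F r') (hT : r.1 = r'.1) : r = r' := by
  obtain ⟨V, W, U, β, x, y, rfl, rfl, hβ⟩ := h.bilin ho
  cases h.det (hβ _ _)
  obtain ⟨W, g, hg, ha⟩ := ha
  cases ha
  refine SumRel.det ⟨U, fun m => β (g m) y, fun m => ?_,
    by rw [map_sum, LinearMap.sum_apply]⟩ h' hT
  have := hF m
  rw [hg] at this
  exact this.det (hβ _ _)

theorem UnRel.sum {o : UnOp} (ho : o.IsConjLin) (ha : SumRel s G a) (h : UnRel o a r)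
    (hF : ∀ m, UnRel o (G m) (F m)) (h' : SumRel s F r') (hT : r.1 = r'.1) : r = r' := by
  obtain ⟨V, U, β, x, rfl, hβ⟩ := h.conjLin ho
  cases h.det (hβ _)
  obtain ⟨W, g, hg, ha⟩ := ha
  cases ha
  refine SumRel.det ⟨U, fun m => β (g m), fun m => ?_, by rw [map_sum]⟩ h' hT
  have := hF m
  rw [hg] at this
  exact this.det (hβ _)

theorem SumRel.add (hF : ∀ m, BinRel .add (G m) (H m) (F m)) (h : SumRel s F r)
    (h₁ : SumRel s G r₁) (h₂ : SumRel s H r₂) (h' : BinRel .add r₁ r₂ r') (hT : r.1 = r'.1) :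
    r = r' := by
  obtain ⟨V, f, hf, rfl⟩ := h
  obtain ⟨V₁, g, hg, rfl⟩ := h₁
  obtain ⟨V₂, k, hk, rfl⟩ := h₂
  cases h'
  cases hT
  rw [← Finset.sum_add_distrib]
  have : f = fun m => g m + k m := funext fun m => by
    have := hF m
    rw [hf, hg, hk] at this
    exact Val.vec_inj (this.det (.add _ _))
  rw [this]

theorem SumRel.zero {V U : VSort} (hF : ∀ m, F m = .vec V 0) (h : SumRel s F r)
    (hT : r.1 = .ground (.vec U)) : r = .vec U 0 := by
  obtain ⟨W, f, hf, rfl⟩ := h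
  cases hT
  have : f = fun _ => 0 := funext fun m => by
    have h := (hf m).symm.trans (hF m)
    obtain rfl := Val.sort_inj h
    exact Val.vec_inj h
  rw [this, Finset.sum_const_zero]

end Sums

/-- The value of a sum `∑_{x ∈ M} A`.  If the set `X` over which `x` ranges is empty, only the last
but one clause still says that `A` has a semantic type. -/
theorem Term.eval_bsum {θ : List Tag} {v : Env θ} {M A : Term} {T : Ty} {r : Val}
    (h : (Term.bsum M T A).eval θ v = some r) :
    ∃ (X : FinSet) (s : Set X) (F : X → Val), M.eval θ v = some (Val.set s) ∧
      (∀ m : X, A.eval (.tm (.ground (.basis X)) :: θ) (Env.push m v) = some (F m)) ∧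
      (A.interp (.tm (.ground (.basis X)) :: θ)).isSome ∧ SumRel s F r := by
  rw [Term.eval_sum, Option.bind_eq_some_iff] at h
  obtain ⟨x, hx, h⟩ := h
  rw [Option.bind_eq_some_iff] at h
  obtain ⟨y, hy, h⟩ := h
  unfold Val.sum at h
  split at h
  · rename_i X s X' V f
    split_ifs at h with hX
    subst hX
    cases h
    simp only [Term.eval, Term.interp] at hy
    generalize T.interp θ = S at hy
    rcases hA : A.interp (.tm S :: θ) with _ | ⟨W, g⟩
    · simp [hA] at hy
    · simp only [hA, Option.map_some, Option.some.injEq] at hy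
      cases hy
      exact ⟨X, s.down, fun m => .vec V (g (⟨m⟩, v)).down, hx,
        fun m => by simp only [Term.eval, hA]; rfl, by simp [hA], V, _, fun m => rfl, rfl⟩
  · cases h

section SumLaws

variable {A B : FinSet} {r r' : Val}

open Classical in
theorem SumRel.of_vec {s : Set A} {F : A → Val} {V : VSort} {x : V.El}
    (h : SumRel s F (.vec V x)) : ∃ f : A → V.El, (∀ m, F m = .vec V (f m)) ∧
      x = ∑ m ∈ Finset.univ.filter (· ∈ s), f m := by
  obtain ⟨W, f, hf, h⟩ := h
  obtain rfl := Val.sort_inj h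
  exact ⟨f, hf, Val.vec_inj h⟩

theorem SumRel.of_univ {F : A → Val} (h : SumRel Set.univ F r) :
    ∃ (V : VSort) (f : A → V.El), (∀ m, F m = .vec V (f m)) ∧ r = .vec V (∑ m, f m) := by
  obtain ⟨V, f, hf, rfl⟩ := h
  exact ⟨V, f, hf, by simp⟩

theorem SumRel.congr {s : Set A} {F F' : A → Val} (h : SumRel s F r) (h' : SumRel s F' r')
    (hF : ∀ m ∈ s, F m = F' m) (hT : r.1 = r'.1) : r = r' := by
  obtain ⟨V, f, hf, rfl⟩ := h
  obtain ⟨W, g, hg, rfl⟩ := h'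
  cases hT
  refine congrArg (Val.vec V) (Finset.sum_congr rfl fun m hm => Val.vec_inj (V := V) ?_)
  rw [← hf, ← hg, hF m (by simpa using hm)]

/-- Exchange of two sums. -/
theorem SumRel.swap {s : Set A} {t : Set B} {F : A → Val} {F' : B → Val} {G : A → B → Val}
    (h : SumRel s F r) (hF : ∀ i, SumRel t (G i) (F i)) (h' : SumRel t F' r')
    (hF' : ∀ j, SumRel s (fun i => G i j) (F' j)) (hT : r.1 = r'.1) : r = r' := by
  obtain ⟨V, f, hf, rfl⟩ := h
  obtain ⟨W, f', hf', rfl⟩ := h'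
  cases hT
  simp only [hf] at hF
  simp only [hf'] at hF'
  choose g hg hfg using fun i => (hF i).of_vec
  choose g' hg' hfg' using fun j => (hF' j).of_vec
  have hgg (i j) : g i j = g' j i := Val.vec_inj ((hg i j).symm.trans (hg' j i))
  refine congrArg (Val.vec V) ?_
  simp only [hfg, hfg', hgg]
  exact Finset.sum_comm

/-- A sum over a product of sets is an iterated sum. -/
theorem SumRel.prod {s : Set A} {t : Set B} {F : A.prod B → Val} {H : A → Val}
    (h : SumRel (A := A.prod B) (s ×ˢ t) F r) (h' : SumRel s H r')
    (hH : ∀ i, SumRel t (fun j => F (i, j)) (H i)) (hT : r.1 = r'.1) : r = r' := by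
  obtain ⟨V, f, hf, rfl⟩ := h
  obtain ⟨W, f', hf', rfl⟩ := h'
  cases hT
  simp only [hf'] at hH
  choose g hg hfg using fun i => (hH i).of_vec
  have hfg' (i j) : f (i, j) = g i j := Val.vec_inj ((hf (i, j)).symm.trans (hg i j))
  refine congrArg (Val.vec V) ?_
  simp only [hfg, ← hfg']
  rw [← Finset.sum_product']
  refine Finset.sum_congr ?_ fun _ _ => rfl
  ext ⟨i, j⟩
  simp

/-- A sum with a single non-zero summand. -/
theorem SumRel.single {s : Set A} {F : A → Val} {j : A} (h : SumRel s F r) (hj : j ∈ s)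
    (hF : ∀ m, m ≠ j → ∃ V, F m = .vec V 0) : r = F j := by
  obtain ⟨V, f, hf, rfl⟩ := h
  rw [hf j, Finset.sum_eq_single_of_mem j (by simpa using hj)]
  intro m _ hm
  obtain ⟨W, hW⟩ := hF m hm
  rw [hf m] at hW
  obtain rfl := Val.sort_inj hW
  exact Val.vec_inj hW

end SumLaws

/-! ### Evaluation of the terms in the axioms -/

section EvalLemmas

variable {θ : List Tag} {v : Env θ} {r r₁ r₂ : Val}

theorem IsZero.eval {z : Term} (h : IsZero z) (θ : List Tag) (v : Env θ) :
    ∃ V, z.eval θ v = some (Val.vec V 0) := by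
  cases h <;> exact ⟨_, rfl⟩

/-- `Term.eval_bsum` for a set whose value is already known. -/
theorem Term.eval_bsum_of {M A : Term} {T : Ty} {X : FinSet} {s : Set X}
    (hM : M.eval θ v = some (Val.set s)) (h : (Term.bsum M T A).eval θ v = some r) :
    ∃ F : X → Val,
      (∀ m : X, A.eval (.tm (.ground (.basis X)) :: θ) (Env.push m v) = some (F m)) ∧
      (A.interp (.tm (.ground (.basis X)) :: θ)).isSome ∧ SumRel s F r := by
  obtain ⟨X', s', F, hM', hF, hi, hs⟩ := Term.eval_bsum h
  cases hM.symm.trans hM'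
  exact ⟨F, hF, hi, hs⟩

theorem Term.eval_inst {u : Term} {S : SemTy} {a : S.El} (hu : u.eval θ v = some ⟨S, a⟩)
    (A : Term) : (A.inst u).eval θ v = A.eval (.tm S :: θ) (a, v) := by
  rcases hi : u.interp θ with _ | ⟨S', g⟩
  · simp [Term.eval, hi] at hu
  · simp only [Term.eval, hi, Option.map_some, Option.some.injEq] at hu
    cases hu
    have h : SubstOk (instIdx .bool) (instTerm u) (θ' := θ) (θ := .tm S :: θ)
        (fun v => (g v, v)) :=
      { idx := fun n => by cases n <;> simp [instIdx, Idx.interp]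
        tm := fun n => by
          cases n with
          | zero => exact hi
          | succ n =>
            rw [lookup_succ]
            change lookup θ n = _
            cases lookup θ n <;> rfl }
    exact Term.eval_subst h A v

theorem Term.eval_instI (A : Term) (σ : Idx) :
    (A.instI σ).eval θ v = A.eval (.idx (σ.interp θ) :: θ) v := by
  have h : SubstOk (instIdx σ) (instTerm (.app .sc0 .sc0)) (θ' := θ)
      (θ := .idx (σ.interp θ) :: θ) (fun v => v) :=
    { idx := fun n => by cases n <;> simp [instIdx, Idx.interp]
      tm := fun n => by
        cases n with
        | zero => rfl
        | succ n =>
          rw [lookup_succ]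
          change lookup θ n = _
          cases lookup θ n <;> rfl }
  exact Term.eval_subst h A v

theorem Term.eval_splitPair {X Y : FinSet} (A : Term) (i : X) (j : Y) :
    A.splitPair.eval (.tm (.ground (.basis Y)) :: .tm (.ground (.basis X)) :: θ)
        (Env.push j (Env.push i v)) =
      A.eval (.tm (.ground (.basis (X.prod Y))) :: θ) (Env.push (X := X.prod Y) (i, j) v) := by
  refine Term.eval_subst
    (θ' := .tm (.ground (.basis Y)) :: .tm (.ground (.basis X)) :: θ)
    (θ := .tm (.ground (.basis (X.prod Y))) :: θ)
    (m := fun w => (⟨(w.2.1.down, w.1.down)⟩, w.2.2))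
    ⟨fun n => ?_, fun n => ?_⟩ A (Env.push j (Env.push i v))
  · cases n <;> simp [Idx.interp]
  · cases n with
    | zero => rfl
    | succ n =>
      simp only [Term.interp, lookup_succ]
      cases lookup θ n <;> rfl

theorem Term.eval_swap {X Y : FinSet} (A : Term) (i : X) (j : Y) :
    (A.ren swapRen).eval (.tm (.ground (.basis X)) :: .tm (.ground (.basis Y)) :: θ)
        (Env.push i (Env.push j v)) =
      A.eval (.tm (.ground (.basis Y)) :: .tm (.ground (.basis X)) :: θ)
        (Env.push j (Env.push i v)) := by
  refine Term.eval_ren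
    (θ' := .tm (.ground (.basis X)) :: .tm (.ground (.basis Y)) :: θ)
    (θ := .tm (.ground (.basis Y)) :: .tm (.ground (.basis X)) :: θ)
    (m := fun w => (w.2.1, w.1, w.2.2)) ⟨fun n => ?_, fun n => ?_⟩ A
    (Env.push i (Env.push j v))
  · rcases n with _ | _ | n <;> simp [Idx.interp, swapRen]
  · rcases n with _ | _ | n
    · rfl
    · rfl
    · simp only [swapRen, lookup_succ]
      cases lookup θ n <;> rfl

theorem Term.eval_merge {X : FinSet} (A : Term) (i : X) :
    (A.ren mergeRen).eval (.tm (.ground (.basis X)) :: θ) (Env.push i v) =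
      A.eval (.tm (.ground (.basis X)) :: .tm (.ground (.basis X)) :: θ)
        (Env.push i (Env.push i v)) := by
  refine Term.eval_ren (θ' := .tm (.ground (.basis X)) :: θ)
    (θ := .tm (.ground (.basis X)) :: .tm (.ground (.basis X)) :: θ)
    (m := fun w => (w.1, w.1, w.2)) ⟨fun n => ?_, fun n => ?_⟩ A (Env.push i v)
  · rcases n with _ | _ | n <;> simp [Idx.interp, mergeRen]
  · rcases n with _ | _ | n
    · rfl
    · rfl
    · simp only [mergeRen, lookup_succ]
      cases lookup θ n <;> rfl

/-- The variable `x := t : T` has the value of `t`. -/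
theorem ValidFor.unfold {Γ : Ctx} {θ : List Tag} {v : Env θ} (h : ValidFor Γ θ v) {n : ℕ}
    {t : Term} {T : Ty} (hn : Γ[n]? = some (.defn t T)) :
    (Term.var n).eval θ v = (t.ren (· + (n + 1))).eval θ v := by
  suffices ∃ (θ₀ : List Tag) (m : Env θ → Env θ₀), RenOk (· + (n + 1)) m ∧
      (Term.var n).eval θ v = t.eval θ₀ (m v) by
    obtain ⟨θ₀, m, hm, h⟩ := this
    rw [h, Term.eval_ren hm]
  induction Γ generalizing θ n with
  | nil => simp at hn
  | cons e Γ ih =>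
    obtain _ | ⟨g, θ⟩ := θ
    · cases e <;> exact h.elim
    cases n with
    | zero =>
      simp only [List.getElem?_cons_zero, Option.some.injEq] at hn
      subst hn
      cases g with
      | idx => exact h.elim
      | tm S => exact ⟨θ, Env.tail (.tm S), .succ _ θ, h.1.symm⟩
    | succ n =>
      have h' : ValidFor Γ θ (Env.tail g v) := by
        cases e <;> cases g <;> first | exact h.elim | exact h.2 | exact h
      obtain ⟨θ₀, m, hm, h₀⟩ := ih h' (by simpa using hn)
      refine ⟨θ₀, fun v => m (Env.tail g v), (RenOk.succ g θ).comp hm, ?_⟩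
      rw [← h₀]
      exact Term.eval_ren (.succ g θ) (.var n) v

theorem Term.eval_inst_push {u : Term} {X : FinSet} {i : X}
    (hu : u.eval θ v = some (Val.basis i)) (A : Term) :
    (A.inst u).eval θ v = A.eval (.tm (.ground (.basis X)) :: θ) (Env.push i v) :=
  Term.eval_inst hu A

theorem Term.eval_beta (T : Ty) (t u : Term) (h₁ : (Term.app (.lam T t) u).eval θ v = some r) :
    (t.inst u).eval θ v = some r := by
  rw [Term.eval_app, Option.bind_eq_some_iff] at h₁
  obtain ⟨x, hx, h₁⟩ := h₁
  rw [Option.bind_eq_some_iff] at h₁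
  obtain ⟨⟨S, a⟩, ha, h₁⟩ := h₁
  rw [Term.eval_inst ha]
  simp only [Term.eval, Term.interp] at hx
  generalize T.interp θ = S' at hx
  rcases hi : t.interp (.tm S' :: θ) with _ | ⟨U, g⟩
  · simp [hi] at hx
  · simp only [hi, Option.map_some, Option.some.injEq] at hx
    cases hx
    simp only [Val.app] at h₁
    split_ifs at h₁ with hS
    subst hS
    simp only [Term.eval, hi]
    exact h₁

theorem Term.eval_ilam {t : Term} (h : (Term.ilam t).eval θ v = some r) :
    ∃ F : (X : FinSet) → Val, (∀ X, t.eval (.idx X :: θ) v = some (F X)) ∧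
      r = ⟨.all fun X => (F X).1, fun X => (F X).2⟩ := by
  change (Sem.all fun X => t.interp (.idx X :: θ)).map _ = _ at h
  unfold Sem.all at h
  split_ifs at h with hX
  · refine ⟨fun X => ⟨_, ((t.interp (.idx X :: θ)).get (hX X)).2 v⟩, fun X => ?_,
      (Option.some.inj h).symm⟩
    exact congrArg (Option.map _) (Option.some_get (hX X)).symm
  · cases h

theorem Term.eval_beta_idx (t : Term) (σ : Idx)
    (h₁ : (Term.iapp (.ilam t) σ).eval θ v = some r) : (t.instI σ).eval θ v = some r := by
  rw [Term.eval_iapp, Option.bind_eq_some_iff] at h₁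
  obtain ⟨x, hx, h₁⟩ := h₁
  obtain ⟨F, hF, rfl⟩ := Term.eval_ilam hx
  rw [Term.eval_instI, hF, ← h₁]
  rfl

/-- A term compared by `δ` with the bound variable of a sum denotes an element of the set over
which the sum ranges, even if that set is empty (and the sum has no summand). -/
theorem Term.eval_of_delta {t : Term} {X : FinSet}
    (h : ((Term.delta (.var 0) t.lift).interp (.tm (.ground (.basis X)) :: θ)).isSome) :
    ∃ j : X, t.eval θ v = some (Val.basis j) := by
  simp only [Term.interp, Term.interp_lift, lookup, Option.bind_some] at h
  rcases hi : t.interp θ with _ | ⟨S, g⟩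
  · simp [hi] at h
  · simp only [hi, Option.map_some, Option.bind_some, Sem.pre] at h
    cases S with
    | arrow | all => cases h
    | ground k =>
      cases k with
      | set | vec => cases h
      | basis Y =>
        simp only [Sem.bin, BinOp.sem] at h
        split_ifs at h with hY
        · subst hY
          exact ⟨(g v).down, by simp only [Term.eval, hi]; rfl⟩
        · cases h

theorem Term.interp_left_isSome {o : BinOp} {t u : Term}
    (h : ((Term.bin o t u).interp θ).isSome) : (t.interp θ).isSome := by
  simp only [Term.interp] at h
  cases hi : t.interp θ with
  | none => simp [hi] at h
  | some => rfl

/-- A bilinear operation commutes with sums in its second argument. -/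
theorem Term.eval_bsum_right {o : BinOp} (ho : o.IsBilin) {X M Y : Term} {T : Ty}
    (h₁ : (Term.bin o X (.bsum M T Y)).eval θ v = some r₁)
    (h₂ : (Term.bsum M T (.bin o X.lift Y)).eval θ v = some r₂) (hT : r₁.1 = r₂.1) : r₁ = r₂ := by
  obtain ⟨x, hx, y, hy, hxy⟩ := Term.eval_bin_iff.mp h₁
  obtain ⟨A, s, G, hM, hG, -, hs⟩ := Term.eval_bsum hy
  obtain ⟨F, hF, -, hs'⟩ := Term.eval_bsum_of hM h₂
  refine hxy.sum_right ho hs (fun m => ?_) hs' hT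
  simpa [Term.eval_bin_iff, Term.eval_lift_push, hx, hG] using hF m

/-- A bilinear operation commutes with sums in its first argument. -/
theorem Term.eval_bsum_left {o : BinOp} (ho : o.IsBilin) {X M Y : Term} {T : Ty}
    (h₁ : (Term.bin o (.bsum M T X) Y).eval θ v = some r₁)
    (h₂ : (Term.bsum M T (.bin o X Y.lift)).eval θ v = some r₂) (hT : r₁.1 = r₂.1) : r₁ = r₂ := by
  obtain ⟨x, hx, y, hy, hxy⟩ := Term.eval_bin_iff.mp h₁
  obtain ⟨A, s, G, hM, hG, -, hs⟩ := Term.eval_bsum hx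
  obtain ⟨F, hF, -, hs'⟩ := Term.eval_bsum_of hM h₂
  refine hxy.sum_left ho hs (fun m => ?_) hs' hT
  simpa [Term.eval_bin_iff, Term.eval_lift_push, hy, hG] using hF m

/-- The adjoint and the conjugate commute with sums. -/
theorem Term.eval_bsum_un {o : UnOp} (ho : o.IsConjLin) {M X : Term} {T : Ty}
    (h₁ : (Term.un o (.bsum M T X)).eval θ v = some r₁)
    (h₂ : (Term.bsum M T (.un o X)).eval θ v = some r₂) (hT : r₁.1 = r₂.1) : r₁ = r₂ := by
  obtain ⟨x, hx, hr⟩ := Term.eval_un_iff.mp h₁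
  obtain ⟨A, s, G, hM, hG, -, hs⟩ := Term.eval_bsum hx
  obtain ⟨F, hF, -, hs'⟩ := Term.eval_bsum_of hM h₂
  refine hr.sum ho hs (fun m => ?_) hs' hT
  simpa [Term.eval_un_iff, hG] using hF m

open Classical in
theorem Term.eval_delta {s t : Term} {X : FinSet} {i j : X} (hs : s.eval θ v = some (Val.basis i))
    (ht : t.eval θ v = some (Val.basis j)) :
    (Term.delta s t).eval θ v = some (Val.vec .scalar (if i = j then (1 : ℂ) else 0)) :=
  Term.eval_bin_iff.mpr ⟨_, hs, _, ht, .delta i j⟩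

/-- Scaling by `0` and by `1`, in particular by a `δ_{i,j}`. -/
theorem BinRel.delta_smul {o : BinOp} (ho : o = .smul ∨ o = .mul) {c : ℂ} {b r : Val}
    (h : BinRel o (.vec .scalar c) b r) : (c = 0 → ∃ V, r = .vec V 0) ∧ (c = 1 → r = b) := by
  have h : BinRel .smul (.vec .scalar c) b r := by
    obtain rfl | rfl := ho
    · exact h
    · exact h.smul_of_mul
  cases h with
  | @smul V c x =>
    exact ⟨fun hc => ⟨V, by rw [hc, _root_.zero_smul]⟩, fun hc => by rw [hc, _root_.one_smul]⟩

theorem Term.eval_bsum_delta {σ : Idx} {T : Ty} {t : Term}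
    (h : (Term.bsum (.univ σ) T (.delta (.var 0) t.lift)).eval θ v = some r) :
    r = .vec .scalar (1 : ℂ) := by
  obtain ⟨F, hF, hi, hs⟩ := Term.eval_bsum_of (X := σ.interp θ) (s := .univ) rfl h
  obtain ⟨j, hj⟩ := Term.eval_of_delta (v := v) hi
  have hF' (m : (σ.interp θ : FinSet)) := (hF m).symm.trans
    (Term.eval_delta (s := .var 0) (i := m) (j := j) rfl ((Term.eval_lift_push _ t).trans hj))
  simp only [Option.some.injEq] at hF'
  rw [hs.single (j := j) (Set.mem_univ j) fun m hm => ⟨.scalar, by rw [hF', if_neg hm]⟩, hF',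
    if_pos rfl]

theorem Term.eval_bsum_delta_smul {o : BinOp} (ho : o = .smul ∨ o = .mul) {σ : Idx} {T : Ty}
    {t A : Term}
    (h : (Term.bsum (.univ σ) T (.bin o (.delta (.var 0) t.lift) A)).eval θ v = some r) :
    (A.inst t).eval θ v = some r := by
  obtain ⟨F, hF, hi, hs⟩ := Term.eval_bsum_of (X := σ.interp θ) (s := .univ) rfl h
  obtain ⟨j, hj⟩ := Term.eval_of_delta (v := v) (Term.interp_left_isSome hi)
  rw [Term.eval_inst_push hj]
  have hF' (m : (σ.interp θ : FinSet)) := Term.eval_bin_iff.mp (hF m)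
  have hd (m : (σ.interp θ : FinSet)) := Term.eval_delta (s := .var 0) (i := m) (j := j) rfl
    ((Term.eval_lift_push m t).trans hj)
  simp only [hd, Option.some.injEq, exists_eq_left'] at hF'
  choose a ha hF' using hF'
  rw [hs.single (j := j) (Set.mem_univ j) fun m hm =>
    (BinRel.delta_smul ho (hF' m)).1 (if_neg hm), ha,
    (BinRel.delta_smul ho (hF' j)).2 (if_pos rfl)]

theorem Term.eval_bsum_bsum_delta {M : Term} {T : Ty}
    (h₁ : (Term.bsum M T (.bsum M.lift T.lift (.delta (.var 1) (.var 0)))).eval θ v = some r₁)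
    (h₂ : (Term.bsum M T .sc1).eval θ v = some r₂) (hT : r₁.1 = r₂.1) : r₁ = r₂ := by
  obtain ⟨X, s, F, hM, hF, -, hs⟩ := Term.eval_bsum h₁
  obtain ⟨F', hF', -, hs'⟩ := Term.eval_bsum_of hM h₂
  choose G hG _ hGs using fun m => Term.eval_bsum_of ((Term.eval_lift_push _ M).trans hM) (hF m)
  refine hs.congr hs' (fun m hm => ?_) hT
  have hG' (k : X) := (hG m k).symm.trans (Term.eval_delta (i := m) (j := k) rfl rfl)
  simp only [Option.some.injEq] at hG'
  rw [(hGs m).single hm fun k hk => ⟨.scalar, by rw [hG', if_neg hk.symm]⟩, hG', if_pos rfl]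
  exact Option.some.inj (hF' m)

theorem Term.eval_bsum_bsum_delta_smul {o : BinOp} (ho : o = .smul ∨ o = .mul) {M A : Term} {T : Ty}
    (h₁ : (Term.bsum M T (.bsum M.lift T.lift
      (.bin o (.delta (.var 1) (.var 0)) A))).eval θ v = some r₁)
    (h₂ : (Term.bsum M T (A.ren mergeRen)).eval θ v = some r₂) (hT : r₁.1 = r₂.1) : r₁ = r₂ := by
  obtain ⟨X, s, F, hM, hF, -, hs⟩ := Term.eval_bsum h₁
  obtain ⟨F', hF', -, hs'⟩ := Term.eval_bsum_of hM h₂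
  choose G hG _ hGs using fun m => Term.eval_bsum_of ((Term.eval_lift_push _ M).trans hM) (hF m)
  refine hs.congr hs' (fun m hm => ?_) hT
  have hG' (k : X) := Term.eval_bin_iff.mp (hG m k)
  have hd (k : X) := Term.eval_delta (i := m) (j := k)
    (θ := .tm (.ground (.basis X)) :: .tm (.ground (.basis X)) :: θ)
    (v := Env.push k (Env.push m v))
    (s := .var 1) (t := .var 0) rfl rfl
  simp only [hd, Option.some.injEq, exists_eq_left'] at hG'
  choose a ha hG' using hG'
  rw [(hGs m).single hm fun k hk => (BinRel.delta_smul ho (hG' k)).1 (if_neg hk.symm),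
    (BinRel.delta_smul ho (hG' m)).2 (if_pos rfl)]
  have := hF' m
  rw [Term.eval_merge, ha] at this
  exact Option.some.inj this

theorem Term.eval_bsum_bool {T : Ty} {A : Term}
    (h₁ : (Term.bsum (.univ .bool) T A).eval θ v = some r₁)
    (h₂ : (Term.add (A.inst .b0) (A.inst .b1)).eval θ v = some r₂) : r₁ = r₂ := by
  obtain ⟨F, hF, -, hs⟩ := Term.eval_bsum_of (X := .bool) (s := .univ) rfl h₁
  obtain ⟨V, f, hf, rfl⟩ := hs.of_univ
  obtain ⟨a, ha, b, hb, h⟩ := Term.eval_bin_iff.mp h₂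
  rw [Term.eval_inst_push (u := .b0) (X := .bool) (i := false) rfl] at ha
  rw [Term.eval_inst_push (u := .b1) (X := .bool) (i := true) rfl] at hb
  cases (hF false).symm.trans ha
  cases (hF true).symm.trans hb
  rw [hf, hf] at h
  cases h
  refine congrArg (Val.vec V) ?_
  exact (Fintype.sum_bool f).trans (_root_.add_comm _ _)

/-- Sums over `M₁ ⋆ M₂` and over `U(σ × τ)`. -/
theorem Term.eval_bsum_prod {M M₁ M₂ A : Term} {T T₁ T₂ : Ty} {X Y : FinSet} {s : Set X}
    {t : Set Y} (hM : M.eval θ v = some (Val.set (A := X.prod Y) (s ×ˢ t)))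
    (hM₁ : M₁.eval θ v = some (Val.set s)) (hM₂ : M₂.eval θ v = some (Val.set t))
    (h₁ : (Term.bsum M T A).eval θ v = some r₁)
    (h₂ : (Term.bsum M₁ T₁ (.bsum M₂.lift T₂ A.splitPair)).eval θ v = some r₂)
    (hT : r₁.1 = r₂.1) : r₁ = r₂ := by
  obtain ⟨F, hF, -, hs⟩ := Term.eval_bsum_of hM h₁
  obtain ⟨H, hH, -, hs'⟩ := Term.eval_bsum_of hM₁ h₂
  choose G hG _ hGs using fun m =>
    Term.eval_bsum_of ((Term.eval_lift_push _ M₂).trans hM₂) (hH m)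
  refine hs.prod hs' (fun m => ?_) hT
  have : G m = fun k => F (m, k) := funext fun k =>
    Option.some.inj ((hG m k).symm.trans ((Term.eval_splitPair A m k).trans (hF (m, k))))
  exact this ▸ hGs m

theorem Term.eval_bsum_swap {M₁ M₂ A : Term} {T₁ T₂ : Ty}
    (h₁ : (Term.bsum M₁ T₁ (.bsum M₂.lift T₂.lift A)).eval θ v = some r₁)
    (h₂ : (Term.bsum M₂ T₂ (.bsum M₁.lift T₁.lift (A.ren swapRen))).eval θ v = some r₂)
    (hT : r₁.1 = r₂.1) : r₁ = r₂ := by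
  obtain ⟨X, s, F, hM₁, hF, -, hs⟩ := Term.eval_bsum h₁
  obtain ⟨Y, t, F', hM₂, hF', -, ht⟩ := Term.eval_bsum h₂
  choose G hG _ hGs using fun m => Term.eval_bsum_of ((Term.eval_lift_push _ M₂).trans hM₂) (hF m)
  choose G' hG' _ hGs' using fun m =>
    Term.eval_bsum_of ((Term.eval_lift_push _ M₁).trans hM₁) (hF' m)
  refine hs.swap hGs ht (fun k => ?_) hT
  have : G' k = fun m => G m k := funext fun m =>
    Option.some.inj ((hG' k m).symm.trans ((Term.eval_swap A _ _).trans (hG m k)))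
  exact this ▸ hGs' k

theorem Term.eval_bsum_outer {σ : Idx} {T : Ty}
    (h : (Term.bsum (.univ σ) T (.dot (.ket (.var 0)) (.bra (.var 0)))).eval θ v = some r)
    (hT : r.1 = .ground (.vec (.opt (σ.interp θ) (σ.interp θ)))) :
    r = .vec (.opt (σ.interp θ) (σ.interp θ)) (ContinuousLinearMap.id ℂ (Hilb (σ.interp θ))) := by
  obtain ⟨F, hF, -, hs⟩ := Term.eval_bsum_of (X := σ.interp θ) (s := .univ) rfl h
  obtain ⟨V, f, hf, rfl⟩ := hs.of_univ
  cases hT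
  have hF' (m : (σ.interp θ : FinSet)) : F m =
      .vec (.opt (σ.interp θ) (σ.interp θ)) ((braOf m).smulRight (ketOf m)) :=
    Option.some.inj <| (hF m).symm.trans <| Term.eval_bin_iff.mpr
      ⟨_, Term.eval_un_iff.mpr ⟨_, rfl, .ket m⟩, _, Term.eval_un_iff.mpr ⟨_, rfl, .bra m⟩,
        .dotKB _ _⟩
  have hf' (m) : f m = (braOf m).smulRight (ketOf m) :=
    Val.vec_inj ((hf m).symm.trans (hF' m))
  refine congrArg (Val.vec _) ?_
  exact (Finset.sum_congr rfl fun m _ => hf' m).trans sum_outer_ketOf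

end EvalLemmas

/-! ### Soundness of the axioms -/

/-- The two sides of an axiom have the same value if they have values of the same semantic type.
That both sides have a value of the same type follows from typing. -/
theorem Ax.eval_eq {Γ : Ctx} {Φ : Hyps} {e₁ e₂ : Term} (h : Ax Γ Φ e₁ e₂) {θ : List Tag}
    {v : Env θ} (hv : ValidFor Γ θ v) (hΦ : Satisfies Φ θ v) {r₁ r₂ : Val}
    (h₁ : e₁.eval θ v = some r₁) (h₂ : e₂.eval θ v = some r₂) (hT : r₁.1 = r₂.1) : r₁ = r₂ := by
  cases h
  case mul_sum b M T a => exact Term.eval_bsum_right .mul h₁ h₂ hT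
  case smul_sum a M T A => exact Term.eval_bsum_right .smul h₁ h₂ hT
  case dot_sum X M T Y => exact Term.eval_bsum_right .dot h₁ h₂ hT
  case tensor_sum X M T Y => exact Term.eval_bsum_right .tensor h₁ h₂ hT
  case sum_smul M T a A => exact Term.eval_bsum_left .smul h₁ h₂ hT
  case sum_dot M T X Y => exact Term.eval_bsum_left .dot h₁ h₂ hT
  case sum_tensor M T X Y => exact Term.eval_bsum_left .tensor h₁ h₂ hT
  case conj_sum M T a => exact Term.eval_bsum_un .conj h₁ h₂ hT
  case dag_sum M T A => exact Term.eval_bsum_un .dag h₁ h₂ hT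
  case sum_delta σ T t => exact (Term.eval_bsum_delta h₁).trans (Option.some.inj h₂)
  case sum_delta_smul σ T t A =>
    exact Option.some.inj ((Term.eval_bsum_delta_smul (.inl rfl) h₁).symm.trans h₂)
  case sum_delta_mul σ T t A =>
    exact Option.some.inj ((Term.eval_bsum_delta_smul (.inr rfl) h₁).symm.trans h₂)
  case sum_sum_delta M T => exact Term.eval_bsum_bsum_delta h₁ h₂ hT
  case sum_sum_delta_smul M T A => exact Term.eval_bsum_bsum_delta_smul (.inl rfl) h₁ h₂ hT
  case sum_sum_delta_mul M T A => exact Term.eval_bsum_bsum_delta_smul (.inr rfl) h₁ h₂ hT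
  case sum_bool T A => exact Term.eval_bsum_bool h₁ h₂
  case sum_swap M₁ M₂ T₁ T₂ A => exact Term.eval_bsum_swap h₁ h₂ hT
  case sum_outer σ =>
    cases h₂
    exact Term.eval_bsum_outer h₁ hT
  case sum_univ_prod σ τ T A =>
    exact Term.eval_bsum_prod (X := σ.interp θ) (Y := τ.interp θ) (s := .univ) (t := .univ)
      (by rw [Set.univ_prod_univ]; rfl) rfl rfl h₁ h₂ hT
  case sum_star M₁ M₂ T T₁ T₂ A =>
    obtain ⟨X, s, F, hM, -⟩ := Term.eval_bsum h₁
    obtain ⟨a, ha, b, hb, h⟩ := Term.eval_bin_iff.mp hM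
    cases h with
    | star s t => exact Term.eval_bsum_prod hM ha hb h₁ h₂ hT
  case sum_zero M T z hz hz' =>
    obtain ⟨U, hU⟩ := hz'.eval θ v
    cases hU.symm.trans h₂
    obtain ⟨X, s, F, hM, hF, -, hs⟩ := Term.eval_bsum h₁
    obtain ⟨V, hV⟩ : ∃ V, ∀ w, z.eval (.tm (.ground (.basis X)) :: θ) w = some (Val.vec V 0) := by
      cases hz <;> exact ⟨_, fun _ => rfl⟩
    exact hs.zero (fun m => Option.some.inj ((hF m).symm.trans (hV _))) hT
  case sum_add M T X₁ X₂ =>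
    obtain ⟨X, s, F, hM, hF, -, hs⟩ := Term.eval_bsum h₁
    obtain ⟨x, hx, y, hy, h⟩ := Term.eval_bin_iff.mp h₂
    obtain ⟨G, hG, -, hs₁⟩ := Term.eval_bsum_of hM hx
    obtain ⟨H, hH, -, hs₂⟩ := Term.eval_bsum_of hM hy
    refine SumRel.add (fun m => ?_) hs hs₁ hs₂ h hT
    simpa [Term.eval_bin_iff, hG, hH] using hF m
  case beta T t u => exact Option.some.inj ((Term.eval_beta T t u h₁).symm.trans h₂)
  case beta_idx t σ => exact Option.some.inj ((Term.eval_beta_idx t σ h₁).symm.trans h₂)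
  case unfold n t T hn => exact Option.some.inj (h₁.symm.trans ((hv.unfold hn).trans h₂))
  all_goals simp only [Term.eval_un_iff, Term.eval_bin_iff] at h₁ h₂
  case conj_dot B K =>
    obtain ⟨w, ⟨x, hx, y, hy, hw⟩, h₁⟩ := h₁
    simp only [hx, hy, Option.some.injEq, exists_eq_left'] at h₂
    obtain ⟨y', hy', x', hx', h₂⟩ := h₂
    cases h₁
    cases hw with
    | dotBK x y =>
      cases hy'
      cases hx'
      cases h₂
      exact congrArg (Val.vec .scalar) (star_apply_ket x y)
  case mul_comm a b =>
    obtain ⟨x, hx, y, hy, h₁⟩ := h₁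
    simp only [hx, hy, Option.some.injEq, exists_eq_left'] at h₂
    cases h₁
    cases h₂
    exact congrArg (Val.vec .scalar) (_root_.mul_comm _ _)
  case mul_assoc a b c =>
    obtain ⟨w, ⟨x, hx, y, hy, hw⟩, z, hz, h₁⟩ := h₁
    simp only [hx, hy, hz, Option.some.injEq, exists_eq_left'] at h₂
    obtain ⟨p, hp, h₂⟩ := h₂
    cases hw
    cases h₁
    cases hp
    cases h₂
    exact congrArg (Val.vec .scalar) (_root_.mul_assoc _ _ _)
  case one_mul =>
    obtain ⟨x, hx, y, hy, h₁⟩ := h₁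
    cases hx
    cases hy.symm.trans h₂
    cases h₁
    exact congrArg (Val.vec .scalar) (_root_.one_mul _)
  case zero_mul a =>
    obtain ⟨x, hx, y, hy, h₁⟩ := h₁
    cases hx
    cases h₂
    cases h₁
    exact congrArg (Val.vec .scalar) (MulZeroClass.zero_mul _)
  case mul_add a b c =>
    obtain ⟨x, hx, w, ⟨y, hy, z, hz, hw⟩, h₁⟩ := h₁
    simp only [hx, hy, hz, Option.some.injEq, exists_eq_left'] at h₂
    obtain ⟨p, hp, q, hq, h₂⟩ := h₂
    exact BinRel.add_right .mul hw h₁ hp hq h₂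
  case conj_zero =>
    obtain ⟨x, hx, h₁⟩ := h₁
    cases hx
    cases h₁
    cases h₂
    exact congrArg (Val.vec .scalar) (map_zero _)
  case conj_one =>
    obtain ⟨x, hx, h₁⟩ := h₁
    cases hx
    cases h₁
    cases h₂
    exact congrArg (Val.vec .scalar) (map_one _)
  case conj_add a b =>
    obtain ⟨w, ⟨x, hx, y, hy, hw⟩, h₁⟩ := h₁
    simp only [hx, hy, Option.some.injEq, exists_eq_left'] at h₂
    obtain ⟨p, hp, q, hq, h₂⟩ := h₂
    exact UnRel.add .conj hw h₁ hp hq h₂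
  case conj_mul a b =>
    obtain ⟨w, ⟨x, hx, y, hy, hw⟩, h₁⟩ := h₁
    simp only [hx, hy, Option.some.injEq, exists_eq_left'] at h₂
    obtain ⟨p, hp, q, hq, h₂⟩ := h₂
    exact UnRel.smul .conj hw.smul_of_mul h₁ hp hq h₂.smul_of_mul
  case conj_conj =>
    obtain ⟨w, ⟨x, hx, hw⟩, h₁⟩ := h₁
    cases hx.symm.trans h₂
    cases hw
    cases h₁
    exact congrArg (Val.vec .scalar) (Complex.conj_conj _)
  case conj_delta s t =>
    obtain ⟨w, ⟨x, hx, y, hy, hw⟩, h₁⟩ := h₁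
    simp only [hx, hy, Option.some.injEq, exists_eq_left'] at h₂
    cases hw
    cases h₁
    cases h₂
    exact congrArg (Val.vec .scalar) (by split_ifs <;> simp)
  case bra_dot_ket s t =>
    obtain ⟨w, ⟨x, hx, hw⟩, z, ⟨y, hy, hz⟩, h₁⟩ := h₁
    simp only [hx, hy, Option.some.injEq, exists_eq_left'] at h₂
    cases hw
    cases hz
    cases h₁
    cases h₂
    exact congrArg (Val.vec .scalar) (by simp)
  case delta_self s =>
    obtain ⟨x, hx, y, hy, h₁⟩ := h₁
    cases hx.symm.trans hy
    cases h₁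
    cases h₂
    exact congrArg (Val.vec .scalar) (if_pos rfl)
  case delta_ne s t hst =>
    obtain ⟨x, hx, y, hy, h₁⟩ := h₁
    cases h₁
    cases h₂
    refine congrArg (Val.vec .scalar) (if_neg ?_)
    rintro rfl
    exact hΦ _ hst (hx.trans hy.symm)
  case delta_comm s t =>
    obtain ⟨x, hx, y, hy, h₁⟩ := h₁
    simp only [hx, hy, Option.some.injEq, exists_eq_left'] at h₂
    cases h₁
    cases h₂
    exact congrArg (Val.vec .scalar) (by simp only [eq_comm])
  case zero_add z hz =>
    obtain ⟨x, hx, y, hy, h₁⟩ := h₁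
    obtain ⟨V, hV⟩ := hz.eval θ v
    cases hV.symm.trans hx
    cases hy.symm.trans h₂
    cases h₁
    exact congrArg (Val.vec _) (_root_.zero_add _)
  case add_comm D₁ D₂ =>
    obtain ⟨x, hx, y, hy, h₁⟩ := h₁
    simp only [hx, hy, Option.some.injEq, exists_eq_left'] at h₂
    cases h₁
    cases h₂
    exact congrArg (Val.vec _) (_root_.add_comm _ _)
  case add_assoc D₁ D₂ D₃ =>
    obtain ⟨w, ⟨x, hx, y, hy, hw⟩, z, hz, h₁⟩ := h₁
    simp only [hx, hy, hz, Option.some.injEq, exists_eq_left'] at h₂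
    obtain ⟨p, hp, h₂⟩ := h₂
    cases hw
    cases h₁
    cases hp
    cases h₂
    exact congrArg (Val.vec _) (_root_.add_assoc _ _ _)
  case zero_smul D hz' =>
    obtain ⟨x, hx, y, hy, h₁⟩ := h₁
    obtain ⟨U, hU⟩ := hz'.eval θ v
    cases hU.symm.trans h₂
    cases hx
    exact BinRel.zero_left .smul (W := .scalar) h₁ hT
  case smul_zero a hz' =>
    obtain ⟨x, hx, y, hy, h₁⟩ := h₁
    obtain ⟨U, hU⟩ := hz'.eval θ v
    cases hU.symm.trans h₂
    cases hU.symm.trans hy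
    exact BinRel.zero_right .smul h₁ hT
  case one_smul =>
    obtain ⟨x, hx, y, hy, h₁⟩ := h₁
    cases hx
    cases hy.symm.trans h₂
    cases h₁
    exact congrArg (Val.vec _) (_root_.one_smul ℂ _)
  case smul_smul a b D =>
    obtain ⟨x, hx, w, ⟨y, hy, z, hz, hw⟩, h₁⟩ := h₁
    simp only [hx, hy, hz, Option.some.injEq, exists_eq_left'] at h₂
    obtain ⟨p, hp, h₂⟩ := h₂
    cases hw
    cases h₁
    cases hp
    cases h₂
    exact congrArg (Val.vec _) (_root_.smul_smul _ _ _)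
  case add_smul a b D =>
    obtain ⟨w, ⟨x, hx, y, hy, hw⟩, z, hz, h₁⟩ := h₁
    simp only [hx, hy, hz, Option.some.injEq, exists_eq_left'] at h₂
    obtain ⟨p, hp, q, hq, h₂⟩ := h₂
    exact BinRel.add_left .smul hw h₁ hp hq h₂
  case smul_add a D₁ D₂ =>
    obtain ⟨x, hx, w, ⟨y, hy, z, hz, hw⟩, h₁⟩ := h₁
    simp only [hx, hy, hz, Option.some.injEq, exists_eq_left'] at h₂
    obtain ⟨p, hp, q, hq, h₂⟩ := h₂
    exact BinRel.add_right .smul hw h₁ hp hq h₂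
  case dot_zero D z hz hz' =>
    obtain ⟨x, hx, y, hy, h₁⟩ := h₁
    obtain ⟨U, hU⟩ := hz'.eval θ v
    cases hU.symm.trans h₂
    obtain ⟨V, hV⟩ := hz.eval θ v
    cases hV.symm.trans hy
    exact BinRel.zero_right .dot h₁ hT
  case zero_dot D z hz hz' =>
    obtain ⟨x, hx, y, hy, h₁⟩ := h₁
    obtain ⟨U, hU⟩ := hz'.eval θ v
    cases hU.symm.trans h₂
    obtain ⟨V, hV⟩ := hz.eval θ v
    cases hV.symm.trans hx
    exact BinRel.zero_left .dot h₁ hT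
  case dot_smul a D₁ D₂ =>
    obtain ⟨x, hx, w, ⟨y, hy, z, hz, hw⟩, h₁⟩ := h₁
    simp only [hx, hy, hz, Option.some.injEq, exists_eq_left'] at h₂
    obtain ⟨p, hp, h₂⟩ := h₂
    exact BinRel.smul_right .dot hw h₁ hp h₂
  case smul_dot a D₁ D₂ =>
    obtain ⟨w, ⟨x, hx, y, hy, hw⟩, z, hz, h₁⟩ := h₁
    simp only [hx, hy, hz, Option.some.injEq, exists_eq_left'] at h₂
    obtain ⟨p, hp, h₂⟩ := h₂
    exact BinRel.smul_left .dot hw h₁ hp h₂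
  case dot_smul_scalar a D₁ D₂ =>
    obtain ⟨x, hx, w, ⟨y, hy, z, hz, hw⟩, h₁⟩ := h₁
    simp only [hx, hy, hz, Option.some.injEq, exists_eq_left'] at h₂
    obtain ⟨p, hp, h₂⟩ := h₂
    exact BinRel.smul_right .dot hw h₁ hp h₂.smul_of_mul
  case smul_dot_scalar a D₁ D₂ =>
    obtain ⟨w, ⟨x, hx, y, hy, hw⟩, z, hz, h₁⟩ := h₁
    simp only [hx, hy, hz, Option.some.injEq, exists_eq_left'] at h₂
    obtain ⟨p, hp, h₂⟩ := h₂
    exact BinRel.smul_left .dot hw h₁ hp h₂.smul_of_mul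
  case dot_add D₀ D₁ D₂ =>
    obtain ⟨x, hx, w, ⟨y, hy, z, hz, hw⟩, h₁⟩ := h₁
    simp only [hx, hy, hz, Option.some.injEq, exists_eq_left'] at h₂
    obtain ⟨p, hp, q, hq, h₂⟩ := h₂
    exact BinRel.add_right .dot hw h₁ hp hq h₂
  case add_dot D₀ D₁ D₂ =>
    obtain ⟨w, ⟨x, hx, y, hy, hw⟩, z, hz, h₁⟩ := h₁
    simp only [hx, hy, hz, Option.some.injEq, exists_eq_left'] at h₂
    obtain ⟨p, hp, q, hq, h₂⟩ := h₂
    exact BinRel.add_left .dot hw h₁ hp hq h₂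
  case tensor_zero D z hz hz' =>
    obtain ⟨x, hx, y, hy, h₁⟩ := h₁
    obtain ⟨U, hU⟩ := hz'.eval θ v
    cases hU.symm.trans h₂
    obtain ⟨V, hV⟩ := hz.eval θ v
    cases hV.symm.trans hy
    exact BinRel.zero_right .tensor h₁ hT
  case zero_tensor D z hz hz' =>
    obtain ⟨x, hx, y, hy, h₁⟩ := h₁
    obtain ⟨U, hU⟩ := hz'.eval θ v
    cases hU.symm.trans h₂
    obtain ⟨V, hV⟩ := hz.eval θ v
    cases hV.symm.trans hx
    exact BinRel.zero_left .tensor h₁ hT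
  case tensor_smul a D₁ D₂ =>
    obtain ⟨x, hx, w, ⟨y, hy, z, hz, hw⟩, h₁⟩ := h₁
    simp only [hx, hy, hz, Option.some.injEq, exists_eq_left'] at h₂
    obtain ⟨p, hp, h₂⟩ := h₂
    exact BinRel.smul_right .tensor hw h₁ hp h₂
  case smul_tensor a D₁ D₂ =>
    obtain ⟨w, ⟨x, hx, y, hy, hw⟩, z, hz, h₁⟩ := h₁
    simp only [hx, hy, hz, Option.some.injEq, exists_eq_left'] at h₂
    obtain ⟨p, hp, h₂⟩ := h₂
    exact BinRel.smul_left .tensor hw h₁ hp h₂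
  case tensor_add D₀ D₁ D₂ =>
    obtain ⟨x, hx, w, ⟨y, hy, z, hz, hw⟩, h₁⟩ := h₁
    simp only [hx, hy, hz, Option.some.injEq, exists_eq_left'] at h₂
    obtain ⟨p, hp, q, hq, h₂⟩ := h₂
    exact BinRel.add_right .tensor hw h₁ hp hq h₂
  case add_tensor D₀ D₁ D₂ =>
    obtain ⟨w, ⟨x, hx, y, hy, hw⟩, z, hz, h₁⟩ := h₁
    simp only [hx, hy, hz, Option.some.injEq, exists_eq_left'] at h₂
    obtain ⟨p, hp, q, hq, h₂⟩ := h₂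
    exact BinRel.add_left .tensor hw h₁ hp hq h₂
  case dag_zero z hz hz' =>
    obtain ⟨x, hx, h₁⟩ := h₁
    obtain ⟨U, hU⟩ := hz'.eval θ v
    cases hU.symm.trans h₂
    obtain ⟨V, hV⟩ := hz.eval θ v
    cases hV.symm.trans hx
    exact UnRel.zero .dag h₁ hT
  case dag_dag =>
    obtain ⟨w, ⟨x, hx, hw⟩, h₁⟩ := h₁
    cases hx.symm.trans h₂
    cases hw <;> cases h₁
    · exact congrArg (Val.vec _) (LinearIsometryEquiv.symm_apply_apply _ _)
    · exact congrArg (Val.vec _) (LinearIsometryEquiv.apply_symm_apply _ _)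
    · exact congrArg (Val.vec _) (ContinuousLinearMap.adjoint_adjoint _)
  case dag_smul a D =>
    obtain ⟨w, ⟨x, hx, y, hy, hw⟩, h₁⟩ := h₁
    simp only [hx, hy, Option.some.injEq, exists_eq_left'] at h₂
    obtain ⟨p, hp, q, hq, h₂⟩ := h₂
    exact UnRel.smul .dag hw h₁ hp hq h₂
  case dag_add D₁ D₂ =>
    obtain ⟨w, ⟨x, hx, y, hy, hw⟩, h₁⟩ := h₁
    simp only [hx, hy, Option.some.injEq, exists_eq_left'] at h₂
    obtain ⟨p, hp, q, hq, h₂⟩ := h₂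
    exact UnRel.add .dag hw h₁ hp hq h₂
  case dag_dot D₁ D₂ =>
    obtain ⟨w, ⟨x, hx, y, hy, hw⟩, h₁⟩ := h₁
    simp only [hx, hy, Option.some.injEq, exists_eq_left'] at h₂
    obtain ⟨p, hp, q, hq, h₂⟩ := h₂
    cases hw <;> cases h₁ <;> cases hp <;> cases hq <;> cases h₂
    · exact congrArg (Val.vec _) (toDual_apply_clm _ _)
    · exact congrArg (Val.vec _) (toDual_symm_comp _ _)
    · exact congrArg (Val.vec _) (adjoint_smulRight _ _)
    · exact congrArg (Val.vec _) (ContinuousLinearMap.adjoint_comp _ _)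
  case dag_tensor D₁ D₂ =>
    obtain ⟨w, ⟨x, hx, y, hy, hw⟩, h₁⟩ := h₁
    simp only [hx, hy, Option.some.injEq, exists_eq_left'] at h₂
    obtain ⟨p, hp, q, hq, h₂⟩ := h₂
    cases hw <;> cases h₁ <;> cases hp <;> cases hq <;> cases h₂
    · exact congrArg (Val.vec _) (toDual_tensorKet _ _)
    · exact congrArg (Val.vec _) (toDual_symm_tensorBra _ _)
    · exact congrArg (Val.vec _) (adjoint_tensorOpt _ _)
  case dot_assoc D₀ D₁ D₂ =>
    obtain ⟨x, hx, w, ⟨y, hy, z, hz, hw⟩, h₁⟩ := h₁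
    simp only [hx, hy, hz, Option.some.injEq, exists_eq_left'] at h₂
    obtain ⟨p, hp, h₂⟩ := h₂
    cases hw <;> cases h₁ <;> cases hp <;> cases h₂
    case dotKB.dotOO.dotOK.dotKB =>
      exact congrArg (Val.vec _) (ContinuousLinearMap.ext fun _ => by simp)
    all_goals rfl
  case tensor_dot_tensor D₁ D₂ D₃ D₄ =>
    obtain ⟨p, ⟨x₁, hx₁, x₂, hx₂, hp⟩, q, ⟨x₃, hx₃, x₄, hx₄, hq⟩, h₁⟩ := h₁
    simp only [hx₁, hx₂, hx₃, hx₄, Option.some.injEq, exists_eq_left'] at h₂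
    obtain ⟨p', hp', q', hq', h₂⟩ := h₂
    -- The products on the right have values, so the factors fit together; from `h₁` alone one could
    -- not conclude this, since `A × C = B × D` does not imply `A = B`.
    cases hp <;> cases hq <;> cases hp' <;> cases hq' <;> cases h₂ <;> cases h₁
    · exact congrArg (Val.vec _) (smulRight_tensor _ _ _ _)
    · exact congrArg (Val.vec _) (tensorBra_comp_tensorOpt _ _ _ _)
    · exact congrArg (Val.vec _) (tensorOpt_tensorKet _ _ _ _)
    · exact congrArg (Val.vec _) (tensorOpt_comp_tensorOpt _ _ _ _)
  case tensor_dot_tensor_scalar B₁ B₂ K₁ K₂ =>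
    obtain ⟨p, ⟨x₁, hx₁, x₂, hx₂, hp⟩, q, ⟨x₃, hx₃, x₄, hx₄, hq⟩, h₁⟩ := h₁
    simp only [hx₁, hx₂, hx₃, hx₄, Option.some.injEq, exists_eq_left'] at h₂
    obtain ⟨p', hp', q', hq', h₂⟩ := h₂
    cases hp <;> cases hq <;> cases hp' <;> cases hq' <;> cases h₂
    cases h₁
    exact congrArg (Val.vec .scalar) (tensorBra_tensorKet _ _ _ _)
  case outer_dot K₁ B K₂ =>
    obtain ⟨w, ⟨x, hx, y, hy, hw⟩, z, hz, h₁⟩ := h₁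
    simp only [hx, hy, hz, Option.some.injEq, exists_eq_left'] at h₂
    obtain ⟨p, hp, h₂⟩ := h₂
    cases hw <;> cases h₁ <;> cases hp <;> cases h₂
    rfl
  case dot_outer B₁ K B₂ =>
    obtain ⟨x, hx, w, ⟨y, hy, z, hz, hw⟩, h₁⟩ := h₁
    simp only [hx, hy, hz, Option.some.injEq, exists_eq_left'] at h₂
    obtain ⟨p, hp, h₂⟩ := h₂
    cases hw <;> cases h₁ <;> cases hp <;> cases h₂
    exact congrArg (Val.vec _) (ContinuousLinearMap.ext fun _ => by simp [_root_.mul_comm])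
  case dag_one σ =>
    obtain ⟨x, hx, h₁⟩ := h₁
    cases hx
    cases h₁
    cases h₂
    exact congrArg (Val.vec _) ContinuousLinearMap.adjoint_id
  case one_dot σ =>
    obtain ⟨x, hx, y, hy, h₁⟩ := h₁
    cases hx
    cases hy.symm.trans h₂
    cases h₁ <;> rfl
  case one_tensor_one σ τ =>
    obtain ⟨x, hx, y, hy, h₁⟩ := h₁
    cases hx
    cases hy
    cases h₁
    cases h₂
    exact congrArg (Val.vec _) tensorOpt_id
  case dag_ket t =>
    obtain ⟨w, ⟨x, hx, hw⟩, h₁⟩ := h₁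
    simp only [hx, Option.some.injEq, exists_eq_left'] at h₂
    cases hw
    cases h₁
    cases h₂
    rfl
  case ket_tensor_ket s t =>
    obtain ⟨p, ⟨x, hx, hp⟩, q, ⟨y, hy, hq⟩, h₁⟩ := h₁
    simp only [hx, hy, Option.some.injEq, exists_eq_left'] at h₂
    obtain ⟨w, hw, h₂⟩ := h₂
    cases hp
    cases hq
    cases h₁
    cases hw
    cases h₂
    exact congrArg (Val.vec _) (tensorKet_ketOf _ _)
  case univ_star_univ σ τ =>
    obtain ⟨x, hx, y, hy, h₁⟩ := h₁
    cases hx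
    cases hy
    cases h₁
    cases h₂
    exact congrArg Val.set Set.univ_prod_univ
  case delta_b0_b1 =>
    obtain ⟨x, hx, y, hy, h₁⟩ := h₁
    cases hx
    cases hy
    cases h₁
    cases h₂
    exact congrArg (Val.vec .scalar) (if_neg Bool.false_ne_true)

/-! ### Soundness of derivations -/

theorem HasType.eval {Γ : Ctx} {t : Term} {T : Ty} (h : HasType Γ t T) {θ : List Tag} {v : Env θ}
    (hv : ValidFor Γ θ v) : ∃ d, t.eval θ v = some ⟨T.interp θ, d⟩ := by
  obtain ⟨f, hf⟩ := h.interp (hv.tagsFor h.wf)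
  exact ⟨f v, by simp only [Term.eval, hf, Option.map_some]⟩

theorem Derivable.hasType {Γ : Ctx} {Φ : Hyps} {e₁ e₂ : Term} {T : Ty}
    (h : Derivable Γ Φ e₁ e₂ T) : HasType Γ e₁ T ∧ HasType Γ e₂ T := by
  induction h with
  | ax _ h₁ h₂ => exact ⟨h₁, h₂⟩
  | refl h => exact ⟨h, h⟩
  | symm _ ih => exact ih.symm
  | trans _ _ ih ih' => exact ⟨ih.1, ih'.2⟩
  | lam _ ih => exact ⟨.lam ih.1, .lam ih.2⟩
  | ilam _ ih => exact ⟨.ilam ih.1, .ilam ih.2⟩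
  | app _ _ ih ih' => exact ⟨.app ih.1 ih'.1, .app ih.2 ih'.2⟩
  | iapp _ hσ ih => exact ⟨.iapp ih.1 hσ, .iapp ih.2 hσ⟩
  | un _ _ h₁ h₂ _ => exact ⟨h₁, h₂⟩
  | bin _ _ _ h₁ h₂ _ _ => exact ⟨h₁, h₂⟩
  | sum _ _ h₁ h₂ _ _ => exact ⟨h₁, h₂⟩

theorem Satisfies.lift {Φ : Hyps} {θ : List Tag} {v : Env θ} (h : Satisfies Φ θ v) (g : Tag)
    {w : Env (g :: θ)} (hw : Env.tail g w = v) : Satisfies Φ.lift (g :: θ) w := by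
  intro p hp
  obtain ⟨q, hq, rfl⟩ := List.mem_map.mp hp
  simp only [Term.eval_ren (.succ g θ), hw]
  exact h q hq

theorem Derivable.eval_eq {Γ : Ctx} {Φ : Hyps} {e₁ e₂ : Term} {T : Ty}
    (h : Derivable Γ Φ e₁ e₂ T) {θ : List Tag} {v : Env θ} (hv : ValidFor Γ θ v)
    (hΦ : Satisfies Φ θ v) : e₁.eval θ v = e₂.eval θ v := by
  induction h generalizing θ with
  | ax h h₁ h₂ =>
    obtain ⟨d₁, hd₁⟩ := h₁.eval hv
    obtain ⟨d₂, hd₂⟩ := h₂.eval hv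
    rw [hd₁, hd₂, h.eval_eq hv hΦ hd₁ hd₂ rfl]
  | refl h => rfl
  | symm _ ih => exact (ih hv hΦ).symm
  | trans _ _ ih ih' => exact (ih hv hΦ).trans (ih' hv hΦ)
  | @lam Γ Φ T U t t' h ih =>
    -- The body is interpreted for all tags, so that its type is also known if `T` has no elements.
    have hθ : TagsFor (.assum T :: Γ) (.tm (T.interp θ) :: θ) := by
      cases h.hasType.1.wf with
      | assumTerm hT => exact ⟨rfl, hv.tagsFor hT.wf⟩
    obtain ⟨f, hf⟩ := h.hasType.1.interp hθ
    obtain ⟨f', hf'⟩ := h.hasType.2.interp hθ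
    have key (a : (T.interp θ).El) : f (a, v) = f' (a, v) := by
      have := ih (θ := .tm (T.interp θ) :: θ) (v := (a, v)) ⟨rfl, hv⟩ (hΦ.lift _ rfl)
      simpa [Term.eval, hf, hf'] using this
    simp only [Term.eval, Term.interp, hf, hf', Option.map_some, key]
  | @ilam Γ Φ U t t' h ih =>
    obtain ⟨d₁, hd₁⟩ := (HasType.ilam h.hasType.1).eval hv
    obtain ⟨d₂, hd₂⟩ := (HasType.ilam h.hasType.2).eval hv
    obtain ⟨F, hF, hF₁⟩ := Term.eval_ilam hd₁
    obtain ⟨G, hG, hG₁⟩ := Term.eval_ilam hd₂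
    have : F = G := funext fun X => Option.some.inj <| (hF X).symm.trans <|
      (ih (θ := .idx X :: θ) (v := v) hv (hΦ.lift (.idx X) rfl)).trans (hG X)
    rw [hd₁, hd₂, hF₁, hG₁, this]
  | app _ _ ih ih' => rw [Term.eval_app, Term.eval_app, ih hv hΦ, ih' hv hΦ]
  | iapp _ _ ih => rw [Term.eval_iapp, Term.eval_iapp, ih hv hΦ]
  | un o _ _ _ ih => rw [Term.eval_un, Term.eval_un, ih hv hΦ]
  | bin o _ _ _ _ ih ih' => rw [Term.eval_bin, Term.eval_bin, ih hv hΦ, ih' hv hΦ]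
  | sum _ _ _ _ ih ih' => rw [Term.eval_sum, Term.eval_sum, ih hv hΦ, ih' hv hΦ]

end Dirac

theorem mainTheorem1 (Γ : Dirac.Ctx) (Φ : Dirac.Hyps) (e₁ e₂ : Dirac.Term) (T : Dirac.Ty)
    (h : Dirac.Derivable Γ Φ e₁ e₂ T) : Dirac.Valid Γ Φ e₁ e₂ T := by
  intro θ v hv hΦ
  obtain ⟨d, hd⟩ := h.hasType.1.eval hv
  exact ⟨d, hd, (h.eval_eq hv hΦ).symm.trans hd⟩
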